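/- **Theorem (Entanglement-breaking channels and divisibility).** A *qubit channel* is a completely positive trace-preserving linear map $\mathcal E$ on $\mathbb C^{2\times 2}$. Let $\hat{\mathcal E}\in\mathbb R^{4\times 4}$ be its matrix in the Pauli basis $A_0,\dots,A_3=\tfrac1{\sqrt2}\{\mathbb 1,\sigma_x,\sigma_y,\sigma_z\}$, that is, $\hat{\mathcal E}_{ij}=\operatorname{tr}\big(A_i^\dagger\,\mathcal E[A_j]\big)$. The channel $\mathcal E$ is *entanglement-breaking* if for every $k\ge 1$ and every density matrix $\sigma$ on $\mathbb C^k\otimes\mathbb C^2$ the state $(\mathrm{id}_k\otimes\mathcal E)[\sigma]$ is separable, i.e. a finite convex combination of product states $\rho_A\otimes\rho_B$. Let $\mathcal L_{\mathrm P}$ be the set of qubit channels that, for every $\varepsilon>0$, can be written as a composition of finitely many positive trace-preserving linear maps $\mathcal E_i$ (not necessarily completely positive) with $\|\mathcal E_i-\mathrm{id}\|<\varepsilon$, and let ${\sf C}^{\mathrm P}$ be the closure of $\mathcal L_{\mathrm P}$ in the set of qubit channels (the choice of the norm is immaterial, the space being finite-dimensional). Let $\mathcal E$ be a qubit channel. Then: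 1. if $\det\hat{\mathcal E}<0$, then $\mathcal E$ is entanglement-breaking; 2. $\mathcal E\notin{\sf C}^{\mathrm P}$ if and only if $\det\hat{\mathcal E}<0$; 3. consequently, if $\mathcal E\notin{\sf C}^{\mathrm P}$, then $\mathcal E$ is entanglement-breaking. -/

import Mathlib

open scoped ComplexOrder Kronecker

namespace QuantumChannel

/-- Linear maps on the operators of a finite-dimensional Hilbert space with orthonormal basis
indexed by `n`. The product in this ring is composition. -/
abbrev Superoperator (n : Type*) : Type _ := Module.End ℂ (Matrix n n ℂ)

/-- Density matrices (states): positive semidefinite matrices of unit trace. -/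
def IsDensityMatrix {n : Type*} [Fintype n] (ρ : Matrix n n ℂ) : Prop :=
  ρ.PosSemidef ∧ ρ.trace = 1

/-- `id_k ⊗ E`: the map `E` is applied to every block of a `k × k` block matrix. -/
def ampliation {n : Type*} (k : ℕ) (E : Superoperator n)
    (M : Matrix (Fin k × n) (Fin k × n) ℂ) : Matrix (Fin k × n) (Fin k × n) ℂ :=
  Matrix.of fun x y => E (Matrix.of fun i j => M (x.1, i) (y.1, j)) x.2 y.2

/-- On product operators, `(id_k ⊗ E)[A ⊗ B] = A ⊗ E[B]`. -/
theorem ampliation_kronecker {n : Type*} (k : ℕ) (E : Superoperator n)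
    (A : Matrix (Fin k) (Fin k) ℂ) (B : Matrix n n ℂ) :
    ampliation k E (A ⊗ₖ B) = A ⊗ₖ E B := by
  ext x y
  have h : (Matrix.of fun i j => (A ⊗ₖ B) (x.1, i) (y.1, j)) = A x.1 y.1 • B := by
    ext i j
    rfl
  change E (Matrix.of fun i j => (A ⊗ₖ B) (x.1, i) (y.1, j)) x.2 y.2 = _
  rw [h, map_smul]
  rfl

/-- `E` preserves the trace. -/
def IsTracePreserving {n : Type*} [Fintype n] (E : Superoperator n) : Prop :=
  ∀ X : Matrix n n ℂ, (E X).trace = X.trace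

/-- PTP maps: positive and trace preserving. -/
def IsPTP {n : Type*} [Fintype n] (E : Superoperator n) : Prop :=
  (∀ X : Matrix n n ℂ, X.PosSemidef → (E X).PosSemidef) ∧ IsTracePreserving E

/-- Quantum channels (CPTP maps): trace preserving, and `id_k ⊗ E` is positive for every `k`. -/
def IsChannel {n : Type*} [Fintype n] (E : Superoperator n) : Prop :=
  (∀ (k : ℕ) (X : Matrix (Fin k × n) (Fin k × n) ℂ),
    X.PosSemidef → (ampliation k E X).PosSemidef) ∧ IsTracePreserving E

/-- Separable states: finite convex combinations of products of states. -/
def IsSeparable {m n : Type*} [Fintype m] [Fintype n] (σ : Matrix (m × n) (m × n) ℂ) : Prop :=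
  ∃ (N : ℕ) (p : Fin N → ℝ) (A : Fin N → Matrix m m ℂ) (B : Fin N → Matrix n n ℂ),
    (∀ i, 0 ≤ p i) ∧ ∑ i, p i = 1 ∧
    (∀ i, IsDensityMatrix (A i)) ∧ (∀ i, IsDensityMatrix (B i)) ∧
    σ = ∑ i, (p i : ℂ) • (A i ⊗ₖ B i)

/-- Entanglement-breaking channels: `(id_k ⊗ E)[σ]` is separable for every ancilla dimension `k`
and every joint state `σ`. -/
def IsEntanglementBreaking {n : Type*} [Fintype n] (E : Superoperator n) : Prop :=
  IsChannel E ∧ ∀ (k : ℕ) (σ : Matrix (Fin k × n) (Fin k × n) ℂ),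
    IsDensityMatrix σ → IsSeparable (ampliation k E σ)

/-- The Hilbert-Schmidt (Frobenius) norm of a superoperator, computed in the basis of matrix units.
All norms on this finite-dimensional space are equivalent. -/
noncomputable def superNorm {n : Type*} [Fintype n] [DecidableEq n] (E : Superoperator n) : ℝ :=
  Real.sqrt (∑ i, ∑ j, ∑ k, ∑ l, ‖E (Matrix.single i j 1) k l‖ ^ 2)

/-- Channels that, for every `ε > 0`, are a composition of finitely many PTP maps which are
`ε`-close to the identity. -/
def infinitesimalProductsP (n : Type*) [Fintype n] [DecidableEq n] : Set (Superoperator n) :=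
  {E | IsChannel E ∧ ∀ ε : ℝ, 0 < ε → ∃ l : List (Superoperator n),
    (∀ F ∈ l, IsPTP F ∧ superNorm (F - 1) < ε) ∧ E = l.prod}

/-- The set `C^P` of channels that are infinitesimal divisible in PTP: the channels in the closure
of `infinitesimalProductsP`. -/
def pInfinitesimalDivisible (n : Type*) [Fintype n] [DecidableEq n] :
    Set (Superoperator n) :=
  {E | IsChannel E ∧ ∀ ε : ℝ, 0 < ε → ∃ F ∈ infinitesimalProductsP n, superNorm (F - E) < ε}

/-- The identity and the three Pauli matrices `σ_x`, `σ_y`, `σ_z`. -/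
def pauli : Fin 4 → Matrix (Fin 2) (Fin 2) ℂ :=
  ![1, !![0, 1; 1, 0], !![0, -Complex.I; Complex.I, 0], !![1, 0; 0, -1]]

/-- The orthonormal Pauli basis `{1, σ_x, σ_y, σ_z} / √2` of the operators of a qubit. -/
noncomputable def pauliBasis (i : Fin 4) : Matrix (Fin 2) (Fin 2) ℂ :=
  ((Real.sqrt 2 : ℝ) : ℂ)⁻¹ • pauli i

/-- The matrix `tr(A_i† E[A_j])` of a qubit map `E` in the Pauli basis `A`. For a positive map
its entries are real, and `det < 0` in the order of `ℂ` says that the determinant is a negative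
real number. -/
noncomputable def pauliMatrix (E : Superoperator (Fin 2)) : Matrix (Fin 4) (Fin 4) ℂ :=
  Matrix.of fun i j => ((pauliBasis i).conjTranspose * E (pauliBasis j)).trace

end QuantumChannel

namespace QuantumChannel

open Matrix

/-! In Bloch coordinates every positive trace-preserving qubit map is an affine map x ↦ t + D x of
the unit ball of ℝ³ into itself, and its Pauli determinant is det D. Everything is decided by the
sign of det D.

Negative determinant excludes divisibility. A PTP map close to the identity has real determinant
close to 1, so products of such maps have positive determinant, and limits have nonnegative
determinant.

Nonnegative determinant gives divisibility. If det D > 0, write D = L R with L the Cholesky factor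
of D Dᵀ and R a rotation. Rotations are products of one-parameter groups. For x ↦ t + L x, the unit
ball is shrunk to the image ellipsoid through a decreasing family of ellipsoids with centre s t and
shape (1-s) 1 - s(1-s) t tᵀ + s D Dᵀ. Nesting is a comparison of support functions
(`support_interpolation_antitone`), and passing from one ellipsoid to a slightly later one is a PTP
map close to the identity (`isPTPDivisible_blochMap_cholesky`). If det D = 0, mixing in a little of
a channel x ↦ Q x / 3 with Q orthogonal makes the determinant positive.

Negative determinant forces entanglement breaking, through a measure-and-prepare form. For a unital
channel with singular values p i, complete positivity is tested against a suitable rotation.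
Orientation reversal makes minus the polar factor a proper rotation, and the test reads ∑ p i ≤ 1;
measuring along the singular directions then realizes the map (`isMeasurePrepare_of_unital`). A
channel sending the closed ball into the open ball is made unital by invertible filters on both
sides. The filters come from a maximizer of det X / det E(X), whose stationarity is exactly trace
preservation of the filtered map (`exists_scaling_point`, `isMeasurePrepare_of_contractive`).
Filters preserve the sign of the determinant and the measure-and-prepare form. The general case is a
limit of contracted channels, and the measure-and-prepare maps with a fixed number of outcomes form
a closed set. -/

/-! ### Bloch coordinates -/

/-- The unnormalized Bloch vector `(tr(σ_x X), tr(σ_y X), tr(σ_z X))`. -/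
def pauliCoord (X : Matrix (Fin 2) (Fin 2) ℂ) : Fin 3 → ℂ :=
  ![X 0 1 + X 1 0, Complex.I * (X 0 1 - X 1 0), X 0 0 - X 1 1]

/-- The operator with trace `c` and unnormalized Bloch vector `y`. -/
noncomputable def ofPauli (c : ℂ) (y : Fin 3 → ℂ) : Matrix (Fin 2) (Fin 2) ℂ :=
  !![(c + y 2) / 2, (y 0 - Complex.I * y 1) / 2; (y 0 + Complex.I * y 1) / 2, (c - y 2) / 2]

theorem trace_ofPauli (c : ℂ) (y : Fin 3 → ℂ) : (ofPauli c y).trace = c := by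
  simp [ofPauli, Matrix.trace_fin_two]; ring

theorem pauliCoord_ofPauli (c : ℂ) (y : Fin 3 → ℂ) : pauliCoord (ofPauli c y) = y := by
  ext i
  fin_cases i
  · simp [pauliCoord, ofPauli]; ring
  · simp [pauliCoord, ofPauli]; linear_combination (-y 1) * Complex.I_mul_I
  · simp [pauliCoord, ofPauli]; ring

theorem ofPauli_pauliCoord (X : Matrix (Fin 2) (Fin 2) ℂ) :
    ofPauli X.trace (pauliCoord X) = X := by
  ext i j
  fin_cases i <;> fin_cases j <;> simp [pauliCoord, ofPauli, Matrix.trace_fin_two]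
  · linear_combination (-(X 0 1 - X 1 0) / 2) * Complex.I_mul_I
  · linear_combination ((X 0 1 - X 1 0) / 2) * Complex.I_mul_I

theorem pauliCoord_add (X Y : Matrix (Fin 2) (Fin 2) ℂ) :
    pauliCoord (X + Y) = pauliCoord X + pauliCoord Y := by
  ext i; fin_cases i <;> simp [pauliCoord] <;> ring

theorem pauliCoord_smul (c : ℂ) (X : Matrix (Fin 2) (Fin 2) ℂ) :
    pauliCoord (c • X) = c • pauliCoord X := by
  ext i; fin_cases i <;> simp [pauliCoord] <;> ring

theorem ofPauli_add (c d : ℂ) (x y : Fin 3 → ℂ) :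
    ofPauli (c + d) (x + y) = ofPauli c x + ofPauli d y := by
  ext i j; fin_cases i <;> fin_cases j <;> simp [ofPauli] <;> ring

theorem ofPauli_smul (c d : ℂ) (x : Fin 3 → ℂ) :
    ofPauli (c * d) (c • x) = c • ofPauli d x := by
  ext i j; fin_cases i <;> fin_cases j <;> simp [ofPauli] <;> ring

theorem ext_pauli {X Y : Matrix (Fin 2) (Fin 2) ℂ} (h : X.trace = Y.trace)
    (h' : pauliCoord X = pauliCoord Y) : X = Y := by
  rw [← ofPauli_pauliCoord X, ← ofPauli_pauliCoord Y, h, h']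

/-- The trace preserving superoperator acting on Bloch vectors as `x ↦ t + D x`. -/
noncomputable def blochMap (t : Fin 3 → ℝ) (D : Matrix (Fin 3) (Fin 3) ℝ) :
    Superoperator (Fin 2) where
  toFun X := ofPauli X.trace fun i => t i * X.trace + ∑ j, D i j * pauliCoord X j
  map_add' X Y := by
    rw [← ofPauli_add, Matrix.trace_add]
    congr 1
    ext i
    simp only [pauliCoord_add, Pi.add_apply, Fin.sum_univ_three]
    ring
  map_smul' c X := by
    rw [RingHom.id_apply, ← ofPauli_smul, Matrix.trace_smul]
    congr 1
    ext i
    simp only [pauliCoord_smul, Pi.smul_apply, Fin.sum_univ_three, smul_eq_mul]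
    ring

theorem blochMap_apply (t : Fin 3 → ℝ) (D : Matrix (Fin 3) (Fin 3) ℝ)
    (X : Matrix (Fin 2) (Fin 2) ℂ) : blochMap t D X =
      ofPauli X.trace fun i => t i * X.trace + ∑ j, D i j * pauliCoord X j := rfl

theorem isTracePreserving_blochMap (t : Fin 3 → ℝ) (D : Matrix (Fin 3) (Fin 3) ℝ) :
    IsTracePreserving (blochMap t D) := fun X => by
  rw [blochMap_apply, trace_ofPauli]

theorem pauliCoord_blochMap (t : Fin 3 → ℝ) (D : Matrix (Fin 3) (Fin 3) ℝ)
    (X : Matrix (Fin 2) (Fin 2) ℂ) (i : Fin 3) : pauliCoord (blochMap t D X) i =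
      t i * X.trace + ∑ j, D i j * pauliCoord X j := by
  rw [blochMap_apply, pauliCoord_ofPauli]

theorem blochMap_mul (t s : Fin 3 → ℝ) (D F : Matrix (Fin 3) (Fin 3) ℝ) :
    blochMap t D * blochMap s F = blochMap (t + D *ᵥ s) (D * F) := by
  ext1 X
  refine ext_pauli ?_ ?_
  · rw [Module.End.mul_apply, isTracePreserving_blochMap, isTracePreserving_blochMap, isTracePreserving_blochMap]
  · ext i
    rw [Module.End.mul_apply, pauliCoord_blochMap, pauliCoord_blochMap, isTracePreserving_blochMap]
    simp only [pauliCoord_blochMap, Pi.add_apply, Matrix.mul_apply, Fin.sum_univ_three,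
      Matrix.mulVec, dotProduct]
    push_cast
    ring

theorem blochMap_one : blochMap 0 1 = 1 := by
  ext1 X
  refine ext_pauli (isTracePreserving_blochMap _ _ _) ?_
  ext i
  rw [pauliCoord_blochMap]
  fin_cases i <;> simp [Fin.sum_univ_three, Matrix.one_apply]

/-- The affine combination of Bloch maps. -/
theorem blochMap_combo (a b : ℝ) (hab : a + b = 1) (t s : Fin 3 → ℝ)
    (D F : Matrix (Fin 3) (Fin 3) ℝ) :
    (a : ℂ) • blochMap t D + (b : ℂ) • blochMap s F
      = blochMap (a • t + b • s) (a • D + b • F) := by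
  have hab' : (a : ℂ) + b = 1 := by exact_mod_cast hab
  ext1 X
  refine ext_pauli ?_ ?_
  · simp only [LinearMap.add_apply, LinearMap.smul_apply, Matrix.trace_add, Matrix.trace_smul,
      isTracePreserving_blochMap _ _ X, smul_eq_mul]
    linear_combination X.trace * hab'
  · ext i
    simp only [LinearMap.add_apply, LinearMap.smul_apply, pauliCoord_add, pauliCoord_smul,
      Pi.add_apply, Pi.smul_apply, pauliCoord_blochMap, smul_eq_mul, Fin.sum_univ_three,
      Matrix.add_apply, Matrix.smul_apply]
    push_cast
    ring

/-! ### Positivity and the Bloch ball -/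

/-- The Hermitian operator with trace `c` and unnormalized Bloch vector `x`. -/
noncomputable def hermPauli (c : ℝ) (x : Fin 3 → ℝ) : Matrix (Fin 2) (Fin 2) ℂ :=
  ofPauli c fun i => (x i : ℂ)

theorem trace_hermPauli (c : ℝ) (x : Fin 3 → ℝ) : (hermPauli c x).trace = c :=
  trace_ofPauli _ _

theorem pauliCoord_hermPauli (c : ℝ) (x : Fin 3 → ℝ) (i : Fin 3) :
    pauliCoord (hermPauli c x) i = x i := by
  rw [hermPauli, pauliCoord_ofPauli]

theorem blochMap_hermPauli (t : Fin 3 → ℝ) (D : Matrix (Fin 3) (Fin 3) ℝ) (c : ℝ)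
    (x : Fin 3 → ℝ) : blochMap t D (hermPauli c x) = hermPauli c (c • t + D *ᵥ x) := by
  refine ext_pauli ?_ ?_
  · rw [isTracePreserving_blochMap, trace_hermPauli, trace_hermPauli]
  · ext i
    simp only [pauliCoord_blochMap, pauliCoord_hermPauli, trace_hermPauli, Pi.add_apply,
      Pi.smul_apply, Matrix.mulVec, dotProduct, smul_eq_mul]
    push_cast
    ring

theorem isHermitian_hermPauli (c : ℝ) (x : Fin 3 → ℝ) : (hermPauli c x).IsHermitian := by
  ext i j
  fin_cases i <;> fin_cases j <;> simp [hermPauli, ofPauli, Matrix.conjTranspose_apply]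
  ring

theorem exists_eq_hermPauli {X : Matrix (Fin 2) (Fin 2) ℂ} (h : X.IsHermitian) :
    ∃ c x, X = hermPauli c x := by
  refine ⟨X.trace.re, fun i => (pauliCoord X i).re, ext_pauli ?_ ?_⟩
  · rw [trace_hermPauli]
    have h0 := h.apply 0 0
    have h1 := h.apply 1 1
    simp only [RCLike.star_def, Complex.conj_eq_iff_im] at h0 h1
    apply Complex.ext <;> simp [Matrix.trace_fin_two, h0, h1]
  · have h0 := h.apply 0 0
    have h1 := h.apply 1 1
    have h2 := h.apply 0 1
    simp only [RCLike.star_def, Complex.conj_eq_iff_im] at h0 h1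
    simp only [RCLike.star_def] at h2
    ext i
    rw [pauliCoord_hermPauli]
    fin_cases i <;> apply Complex.ext <;> simp [pauliCoord, h0, h1, ← h2]

/-- Cayley–Hamilton for a 2 × 2 matrix. -/
theorem hermPauli_mul_self (c : ℝ) (x : Fin 3 → ℝ) :
    hermPauli c x * hermPauli c x =
      (c : ℂ) • hermPauli c x - (((c ^ 2 - x ⬝ᵥ x) / 4 : ℝ) : ℂ) • (1 : Matrix _ _ ℂ) := by
  ext i j
  fin_cases i <;> fin_cases j <;>
    simp [hermPauli, ofPauli, Matrix.mul_apply, dotProduct, Fin.sum_univ_three]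
  · linear_combination (-(x 1 : ℂ) ^ 2 / 4) * Complex.I_mul_I
  · ring
  · ring
  · linear_combination (-(x 1 : ℂ) ^ 2 / 4) * Complex.I_mul_I

theorem det_hermPauli (c : ℝ) (x : Fin 3 → ℝ) :
    (hermPauli c x).det = (((c ^ 2 - x ⬝ᵥ x) / 4 : ℝ) : ℂ) := by
  simp [hermPauli, ofPauli, Matrix.det_fin_two, dotProduct, Fin.sum_univ_three]
  linear_combination ((x 1 : ℂ) ^ 2 / 4) * Complex.I_mul_I

theorem posSemidef_hermPauli {c : ℝ} {x : Fin 3 → ℝ} :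
    (hermPauli c x).PosSemidef ↔ 0 ≤ c ∧ x ⬝ᵥ x ≤ c ^ 2 := by
  constructor
  · intro h
    have h1 := h.trace_nonneg
    have h2 := h.det_nonneg
    rw [trace_hermPauli] at h1
    rw [det_hermPauli] at h2
    norm_cast at h1 h2
    exact ⟨h1, by linarith⟩
  · rintro ⟨h1, h2⟩
    rcases h1.eq_or_lt with rfl | h1
    · have h3 : x ⬝ᵥ x = 0 := by
        refine le_antisymm (by simpa using h2) ?_
        simp only [dotProduct]
        exact Finset.sum_nonneg fun i _ => mul_self_nonneg _
      rw [dotProduct_self_eq_zero] at h3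
      subst h3
      have : hermPauli 0 0 = 0 := by
        ext i j; fin_cases i <;> fin_cases j <;> simp [hermPauli, ofPauli]
      rw [this]
      exact Matrix.PosSemidef.zero
    -- Cayley–Hamilton exhibits c X as X†X plus a nonnegative multiple of the identity, which avoids
    -- eigenvalues.
    · have key : hermPauli c x = ((c⁻¹ : ℝ) : ℂ) • ((hermPauli c x)ᴴ * hermPauli c x
          + (((c ^ 2 - x ⬝ᵥ x) / 4 : ℝ) : ℂ) • (1 : Matrix _ _ ℂ)) := by
        rw [(isHermitian_hermPauli c x).eq, hermPauli_mul_self, sub_add_cancel, smul_smul]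
        norm_cast
        rw [inv_mul_cancel₀ h1.ne', one_smul]
      rw [key]
      refine Matrix.PosSemidef.smul ?_ (by exact_mod_cast (inv_pos.mpr h1).le)
      refine (Matrix.posSemidef_conjTranspose_mul_self _).add (Matrix.PosSemidef.one.smul ?_)
      have : 0 ≤ (c ^ 2 - x ⬝ᵥ x) / 4 := by linarith
      exact_mod_cast this

theorem dotProduct_self_nonneg (x : Fin 3 → ℝ) : 0 ≤ x ⬝ᵥ x :=
  Finset.sum_nonneg fun i _ => mul_self_nonneg (x i)

theorem eq_smul_add_sum_smul (X : Matrix (Fin 2) (Fin 2) ℂ) :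
    X = X.trace • hermPauli 1 0 + ∑ j, pauliCoord X j • hermPauli 0 (Pi.single j 1) := by
  ext i j
  fin_cases i <;> fin_cases j <;>
    simp [pauliCoord, hermPauli, ofPauli, Matrix.trace_fin_two, Fin.sum_univ_three]
  · ring
  · linear_combination ((X 0 1 - X 1 0) / 2) * Complex.I_mul_I
  · linear_combination (-(X 0 1 - X 1 0) / 2) * Complex.I_mul_I
  · ring

/-- A positive map sends differences of positive operators to Hermitian ones, so the images of the
Pauli directions have real coordinates; linearity and trace preservation do the rest. -/
theorem IsPTP.exists_eq_blochMap {E : Superoperator (Fin 2)} (hE : IsPTP E) :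
    ∃ t D, E = blochMap t D := by
  have h1 : (E (hermPauli 1 0)).IsHermitian :=
    (hE.1 _ (posSemidef_hermPauli.mpr (by simp))).isHermitian
  have h2 (j : Fin 3) : (E (hermPauli 0 (Pi.single j 1))).IsHermitian := by
    have e : hermPauli 0 (Pi.single j 1) = hermPauli 1 (Pi.single j 1) - hermPauli 1 0 := by
      rw [eq_sub_iff_add_eq, hermPauli, hermPauli, ← ofPauli_add, hermPauli]
      congr 1
      · simp
      · ext i; simp
    rw [e, map_sub]
    exact (hE.1 _ (posSemidef_hermPauli.mpr (by simp))).isHermitian.sub h1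
  obtain ⟨c, t, ht⟩ := exists_eq_hermPauli h1
  choose d D hD using fun j => exists_eq_hermPauli (h2 j)
  refine ⟨t, Matrix.of fun i j => D j i, ?_⟩
  ext1 X
  refine ext_pauli ?_ ?_
  · rw [hE.2, isTracePreserving_blochMap]
  · ext i
    rw [pauliCoord_blochMap]
    conv_lhs => rw [eq_smul_add_sum_smul X]
    simp only [map_add, map_smul, ht, hD, Fin.sum_univ_three, pauliCoord_add,
      pauliCoord_smul, Pi.add_apply, Pi.smul_apply, pauliCoord_hermPauli, smul_eq_mul, of_apply]
    ring

theorem isPTP_blochMap {t : Fin 3 → ℝ} {D : Matrix (Fin 3) (Fin 3) ℝ} :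
    IsPTP (blochMap t D) ↔
      ∀ x : Fin 3 → ℝ, x ⬝ᵥ x ≤ 1 → (t + D *ᵥ x) ⬝ᵥ (t + D *ᵥ x) ≤ 1 := by
  constructor
  · intro h x hx
    have := h.1 (hermPauli 1 x) (posSemidef_hermPauli.mpr (by simpa using hx))
    rw [blochMap_hermPauli, posSemidef_hermPauli] at this
    simpa using this.2
  · intro h
    refine ⟨fun X hX => ?_, isTracePreserving_blochMap t D⟩
    obtain ⟨c, x, rfl⟩ := exists_eq_hermPauli hX.isHermitian
    rw [posSemidef_hermPauli] at hX
    rw [blochMap_hermPauli, posSemidef_hermPauli]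
    refine ⟨hX.1, ?_⟩
    -- The ball condition concerns unit trace only: positive trace is rescaled to it, and trace zero
    -- forces the operator to vanish.
    rcases hX.1.eq_or_lt with hc | hc
    · have h0 : x ⬝ᵥ x = 0 :=
        le_antisymm (by simpa [← hc] using hX.2) (dotProduct_self_nonneg x)
      rw [dotProduct_self_eq_zero] at h0
      simp [h0, ← hc]
    · have h1 := h (c⁻¹ • x) (by
        rw [dotProduct_smul, smul_dotProduct, smul_eq_mul, smul_eq_mul, ← mul_assoc, ← mul_inv,
          ← sq, inv_mul_le_one₀ (by positivity)]
        exact hX.2)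
      have h2 : c • t + D *ᵥ x = c • (t + D *ᵥ (c⁻¹ • x)) := by
        rw [Matrix.mulVec_smul, smul_add, smul_smul, mul_inv_cancel₀ hc.ne', one_smul]
      rw [h2, dotProduct_smul, smul_dotProduct, smul_eq_mul, smul_eq_mul, ← mul_assoc, ← sq]
      exact mul_le_of_le_one_right (by positivity) h1

/-! ### Determinant and trace in the Pauli basis -/

theorem trace_pauliBasis_zero_mul (X : Matrix (Fin 2) (Fin 2) ℂ) :
    ((pauliBasis 0).conjTranspose * X).trace = ((Real.sqrt 2 : ℝ) : ℂ)⁻¹ * X.trace := by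
  simp [pauliBasis, pauli, Matrix.trace_fin_two]

theorem trace_pauliBasis_succ_mul (k : Fin 3) (X : Matrix (Fin 2) (Fin 2) ℂ) :
    ((pauliBasis k.succ).conjTranspose * X).trace
      = ((Real.sqrt 2 : ℝ) : ℂ)⁻¹ * pauliCoord X k := by
  fin_cases k <;>
    simp [pauliBasis, pauli, Matrix.trace_fin_two, Matrix.mul_apply, pauliCoord] <;> ring

theorem pauliBasis_zero : pauliBasis 0 = ((Real.sqrt 2 : ℝ) : ℂ)⁻¹ • hermPauli 2 0 := by
  rw [pauliBasis]
  congr 1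
  ext i j
  fin_cases i <;> fin_cases j <;> simp [pauli, hermPauli, ofPauli]

theorem pauliBasis_succ (k : Fin 3) :
    pauliBasis k.succ = ((Real.sqrt 2 : ℝ) : ℂ)⁻¹ • hermPauli 0 (Pi.single k 2) := by
  rw [pauliBasis]
  congr 1
  ext i j
  fin_cases k <;> fin_cases i <;> fin_cases j <;> simp [pauli, hermPauli, ofPauli]
  ring

theorem inv_sqrt_two_mul_self :
    ((Real.sqrt 2 : ℝ) : ℂ)⁻¹ * ((Real.sqrt 2 : ℝ) : ℂ)⁻¹ = 1 / 2 := by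
  rw [← mul_inv]
  norm_cast
  rw [Real.mul_self_sqrt (by norm_num)]
  norm_num

/-- Coordinates with respect to the Pauli basis. -/
noncomputable def pauliEquiv : Matrix (Fin 2) (Fin 2) ℂ ≃ₗ[ℂ] (Fin 4 → ℂ) where
  toFun X i := ((pauliBasis i).conjTranspose * X).trace
  map_add' X Y := by ext i; simp [Matrix.mul_add]
  map_smul' c X := by ext i; simp
  invFun f := ∑ i, f i • pauliBasis i
  left_inv X := by
    beta_reduce
    rw [Fin.sum_univ_succ, trace_pauliBasis_zero_mul, pauliBasis_zero]
    simp only [trace_pauliBasis_succ_mul]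
    simp only [pauliBasis_succ, smul_smul]
    conv_rhs => rw [eq_smul_add_sum_smul X]
    have e (k : Fin 3) : hermPauli 0 (Pi.single k 2) = (2 : ℂ) • hermPauli 0 (Pi.single k 1) := by
      rw [hermPauli, hermPauli, ← ofPauli_smul]
      congr 1
      · simp
      · ext i
        by_cases h : i = k <;> simp [Pi.single_apply, h]
    have e' : hermPauli 2 0 = (2 : ℂ) • hermPauli 1 0 := by
      rw [hermPauli, hermPauli, ← ofPauli_smul]
      congr 1
      · simp
      · ext i; simp
    simp only [e, e', smul_smul]
    congr 1
    · congr 1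
      linear_combination (2 * X.trace) * inv_sqrt_two_mul_self
    · refine Finset.sum_congr rfl fun k _ => ?_
      congr 1
      linear_combination (2 * pauliCoord X k) * inv_sqrt_two_mul_self
  right_inv f := by
    ext i
    beta_reduce
    have h := inv_sqrt_two_mul_self
    refine Fin.cases ?_ (fun k => ?_) i
    · rw [trace_pauliBasis_zero_mul, Matrix.trace_sum, Fin.sum_univ_succ]
      simp only [pauliBasis_zero, pauliBasis_succ, Matrix.trace_smul, trace_hermPauli]
      simp
      linear_combination (2 * f 0) * h
    · rw [trace_pauliBasis_succ_mul, Fin.sum_univ_four]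
      simp only [pauliCoord_add, pauliCoord_smul, Pi.add_apply, Pi.smul_apply, pauliBasis_zero,
        show (1 : Fin 4) = Fin.succ 0 from rfl, show (2 : Fin 4) = Fin.succ 1 from rfl,
        show (3 : Fin 4) = Fin.succ 2 from rfl, pauliBasis_succ, pauliCoord_hermPauli]
      fin_cases k
      · simp; linear_combination (2 * f 1) * h
      · simp; linear_combination (2 * f 2) * h
      · simp; linear_combination (2 * f 3) * h

/-- Makes the determinant and trace of the Pauli matrix basis-free, hence multiplicative and cyclic
respectively under composition. -/
theorem pauliMatrix_eq_toMatrix (E : Superoperator (Fin 2)) :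
    pauliMatrix E = LinearMap.toMatrix (Module.Basis.ofEquivFun pauliEquiv)
      (Module.Basis.ofEquivFun pauliEquiv) E := by
  ext i j
  have : Module.Basis.ofEquivFun pauliEquiv j = pauliBasis j := by
    rw [Module.Basis.coe_ofEquivFun]
    change ∑ i, (Pi.single j (1 : ℂ) : Fin 4 → ℂ) i • pauliBasis i = _
    simp [Pi.single_apply]
  rw [LinearMap.toMatrix_apply, this]
  rfl

theorem det_pauliMatrix (E : Superoperator (Fin 2)) :
    (pauliMatrix E).det = LinearMap.det E := by
  rw [pauliMatrix_eq_toMatrix, LinearMap.det_toMatrix]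

theorem trace_pauliMatrix (E : Superoperator (Fin 2)) :
    (pauliMatrix E).trace = LinearMap.trace ℂ _ E := by
  rw [pauliMatrix_eq_toMatrix, LinearMap.trace_eq_matrix_trace ℂ (Module.Basis.ofEquivFun pauliEquiv)]

theorem pauliMatrix_blochMap_zero_zero (t : Fin 3 → ℝ) (D : Matrix (Fin 3) (Fin 3) ℝ) :
    pauliMatrix (blochMap t D) 0 0 = 1 := by
  rw [pauliMatrix, of_apply, trace_pauliBasis_zero_mul, isTracePreserving_blochMap, pauliBasis_zero,
    Matrix.trace_smul, trace_hermPauli, smul_eq_mul, ← mul_assoc, inv_sqrt_two_mul_self]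
  norm_num

theorem pauliMatrix_blochMap_zero_succ (t : Fin 3 → ℝ) (D : Matrix (Fin 3) (Fin 3) ℝ)
    (k : Fin 3) : pauliMatrix (blochMap t D) 0 k.succ = 0 := by
  rw [pauliMatrix, of_apply, trace_pauliBasis_zero_mul, isTracePreserving_blochMap, pauliBasis_succ,
    Matrix.trace_smul, trace_hermPauli]
  simp

theorem pauliMatrix_blochMap_succ_succ (t : Fin 3 → ℝ) (D : Matrix (Fin 3) (Fin 3) ℝ)
    (i j : Fin 3) : pauliMatrix (blochMap t D) i.succ j.succ = D i j := by
  rw [pauliMatrix, of_apply, trace_pauliBasis_succ_mul, pauliCoord_blochMap, pauliBasis_succ,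
    Matrix.trace_smul, trace_hermPauli]
  simp only [pauliCoord_smul, Pi.smul_apply, pauliCoord_hermPauli, Pi.single_apply]
  have h := inv_sqrt_two_mul_self
  fin_cases j <;> simp [Fin.sum_univ_three]
  · linear_combination (2 * (D i 0 : ℂ)) * h
  · linear_combination (2 * (D i 1 : ℂ)) * h
  · linear_combination (2 * (D i 2 : ℂ)) * h

theorem det_blochMap (t : Fin 3 → ℝ) (D : Matrix (Fin 3) (Fin 3) ℝ) :
    LinearMap.det (blochMap t D) = (D.det : ℂ) := by
  rw [← det_pauliMatrix, Matrix.det_succ_row_zero, Fin.sum_univ_succ,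
    pauliMatrix_blochMap_zero_zero]
  simp only [pauliMatrix_blochMap_zero_succ, mul_zero, zero_mul, Finset.sum_const_zero]
  have : (pauliMatrix (blochMap t D)).submatrix Fin.succ (Fin.succAbove 0)
      = D.map Complex.ofRealHom := by
    ext i j
    simp [pauliMatrix_blochMap_succ_succ]
  rw [this, ← RingHom.mapMatrix_apply, ← RingHom.map_det]
  simp

theorem trace_blochMap (t : Fin 3 → ℝ) (D : Matrix (Fin 3) (Fin 3) ℝ) :
    LinearMap.trace ℂ _ (blochMap t D) = ((1 + D.trace : ℝ) : ℂ) := by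
  rw [← trace_pauliMatrix, Matrix.trace, Fin.sum_univ_succ]
  simp only [Matrix.diag_apply, pauliMatrix_blochMap_zero_zero, pauliMatrix_blochMap_succ_succ,
    Matrix.trace]
  push_cast
  rfl

/-! ### Norm estimates and continuity -/

theorem norm_apply_single_le_superNorm {n : Type*} [Fintype n] [DecidableEq n]
    (E : Superoperator n) (i j k l : n) : ‖E (Matrix.single i j 1) k l‖ ≤ superNorm E := by
  refine Real.le_sqrt_of_sq_le ?_
  calc ‖E (Matrix.single i j 1) k l‖ ^ 2
      ≤ ∑ l, ‖E (Matrix.single i j 1) k l‖ ^ 2 :=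
        Finset.single_le_sum (f := fun l => ‖E (Matrix.single i j 1) k l‖ ^ 2)
          (fun _ _ => by positivity) (Finset.mem_univ l)
    _ ≤ ∑ k, ∑ l, ‖E (Matrix.single i j 1) k l‖ ^ 2 :=
        Finset.single_le_sum (f := fun k => ∑ l, ‖E (Matrix.single i j 1) k l‖ ^ 2)
          (fun _ _ => by positivity) (Finset.mem_univ k)
    _ ≤ ∑ j, ∑ k, ∑ l, ‖E (Matrix.single i j 1) k l‖ ^ 2 :=
        Finset.single_le_sum (f := fun j => ∑ k, ∑ l, ‖E (Matrix.single i j 1) k l‖ ^ 2)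
          (fun _ _ => by positivity) (Finset.mem_univ j)
    _ ≤ ∑ i, ∑ j, ∑ k, ∑ l, ‖E (Matrix.single i j 1) k l‖ ^ 2 :=
        Finset.single_le_sum (f := fun i => ∑ j, ∑ k, ∑ l, ‖E (Matrix.single i j 1) k l‖ ^ 2)
          (fun _ _ => by positivity) (Finset.mem_univ i)

theorem superNorm_smul {n : Type*} [Fintype n] [DecidableEq n] (c : ℂ) (E : Superoperator n) :
    superNorm (c • E) = ‖c‖ * superNorm E := by
  simp only [superNorm, LinearMap.smul_apply, Matrix.smul_apply, smul_eq_mul, norm_mul, mul_pow,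
    ← Finset.mul_sum]
  rw [Real.sqrt_mul (by positivity), Real.sqrt_sq (norm_nonneg _)]

theorem superNorm_zero {n : Type*} [Fintype n] [DecidableEq n] :
    superNorm (0 : Superoperator n) = 0 := by
  simp [superNorm]

/-- The determinant is a polynomial in the matrix entries, and `superNorm` dominates each entry. -/
theorem exists_superNorm_sub_lt_imp_det_sub_lt {n : Type*} [Fintype n] [DecidableEq n]
    (E : Superoperator n) {η : ℝ} (hη : 0 < η) :
    ∃ δ > 0, ∀ F : Superoperator n, superNorm (F - E) < δ →
      ‖LinearMap.det F - LinearMap.det E‖ < η := by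
  let g : (n × n → n × n → ℂ) → ℂ := fun M => (Matrix.of M).det
  have hg : Continuous g := Continuous.matrix_det (A := fun M => Matrix.of M) continuous_id
  let e : Superoperator n → (n × n → n × n → ℂ) := fun F p q =>
    F (Matrix.single q.1 q.2 1) p.1 p.2
  have he (F : Superoperator n) : LinearMap.det F = g (e F) := by
    rw [← LinearMap.det_toMatrix (Matrix.stdBasis ℂ n n)]
    congr 1
    ext p q
    rw [LinearMap.toMatrix_apply, Matrix.stdBasis_eq_single]
    rfl
  obtain ⟨δ, hδ, h⟩ := Metric.continuous_iff.mp hg (e E) η hη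
  refine ⟨δ, hδ, fun F hF => ?_⟩
  rw [he, he, ← dist_eq_norm]
  refine h _ ?_
  simp only [dist_pi_lt_iff hδ]
  intro p q
  rw [dist_eq_norm]
  exact (norm_apply_single_le_superNorm (F - E) q.1 q.2 p.1 p.2).trans_lt hF

theorem continuous_superNorm_blochMap_sub {α : Type*} [TopologicalSpace α]
    {t : α → Fin 3 → ℝ} {D : α → Matrix (Fin 3) (Fin 3) ℝ} (ht : Continuous t)
    (hD : Continuous D) (E : Superoperator (Fin 2)) :
    Continuous fun a => superNorm (blochMap (t a) (D a) - E) := by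
  have h1 (i : Fin 3) : Continuous fun a => t a i := (continuous_apply i).comp ht
  have h2 (i j : Fin 3) : Continuous fun a => D a i j := hD.matrix_elem i j
  refine Real.continuous_sqrt.comp ?_
  refine continuous_finsetSum _ fun i _ => continuous_finsetSum _ fun j _ =>
    continuous_finsetSum _ fun k _ => continuous_finsetSum _ fun l _ => ?_
  refine (Continuous.norm ?_).pow 2
  simp only [LinearMap.sub_apply, Matrix.sub_apply, blochMap_apply]
  refine Continuous.sub ?_ continuous_const
  fin_cases k <;> fin_cases l <;> simp [ofPauli, Fin.sum_univ_three] <;> fun_prop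

/-! ### Products of near-identity maps and the sign of the determinant -/

/-- Compositions of PTP maps arbitrarily close to the identity. -/
def IsPTPDivisible {n : Type*} [Fintype n] [DecidableEq n] (E : Superoperator n) : Prop :=
  ∀ ε : ℝ, 0 < ε → ∃ l : List (Superoperator n),
    (∀ F ∈ l, IsPTP F ∧ superNorm (F - 1) < ε) ∧ E = l.prod

theorem IsPTPDivisible.mul {n : Type*} [Fintype n] [DecidableEq n] {E F : Superoperator n}
    (hE : IsPTPDivisible E) (hF : IsPTPDivisible F) : IsPTPDivisible (E * F) := by
  intro ε hε
  obtain ⟨l, hl, rfl⟩ := hE ε hε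
  obtain ⟨m, hm, rfl⟩ := hF ε hε
  refine ⟨l ++ m, fun G hG => ?_, List.prod_append.symm⟩
  rcases List.mem_append.mp hG with h | h
  exacts [hl G h, hm G h]

/-- The end point of a continuous divisible path of PTP maps starting at the identity. -/
theorem isPTPDivisible_of_path {n : Type*} [Fintype n] [DecidableEq n]
    (ψ : unitInterval → unitInterval → Superoperator n)
    (hmul : ∀ r s u, r ≤ s → s ≤ u → ψ r s * ψ s u = ψ r u) (hself : ∀ r, ψ r r = 1)
    (hcont : Continuous fun p : unitInterval × unitInterval => superNorm (ψ p.1 p.2 - 1))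
    (hptp : ∀ r s, r ≤ s → IsPTP (ψ r s)) : IsPTPDivisible (ψ 0 1) := by
  intro ε hε
  -- Uniform continuity on the compact square provides one mesh size for which every short step is
  -- ε-close to its value on the diagonal, the identity.
  obtain ⟨δ, hδ, h⟩ := Metric.uniformContinuous_iff.mp
    (CompactSpace.uniformContinuous_of_continuous hcont) ε hε
  obtain ⟨N, hN⟩ := exists_nat_one_div_lt hδ
  have hN' : (0 : ℝ) < N + 1 := by positivity
  let p : ℕ → unitInterval := fun k => Set.projIcc 0 1 zero_le_one ((k : ℝ) / (N + 1))
  have hp : Monotone p := fun a b hab => Set.monotone_projIcc _ (by gcongr)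
  have hprod (m : ℕ) :
      ((List.range m).map fun k => ψ (p k) (p (k + 1))).prod = ψ (p 0) (p m) := by
    induction m with
    | zero => simp [hself]
    | succ m ih =>
      rw [List.range_succ, List.map_append, List.prod_append, ih]
      simpa using hmul _ _ _ (hp (Nat.zero_le m)) (hp (Nat.le_succ m))
  refine ⟨(List.range (N + 1)).map fun k => ψ (p k) (p (k + 1)), ?_, ?_⟩
  · intro F hF
    obtain ⟨k, -, rfl⟩ := List.mem_map.mp hF
    refine ⟨hptp _ _ (hp (Nat.le_succ k)), ?_⟩
    have hd : dist (p k, p (k + 1)) (p k, p k) < δ := by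
      rw [Prod.dist_eq, dist_self, max_eq_right dist_nonneg]
      refine lt_of_le_of_lt ?_ hN
      rw [Subtype.dist_eq, Real.dist_eq]
      refine (Set.abs_projIcc_sub_projIcc zero_le_one).trans ?_
      rw [← sub_div, abs_div, abs_of_pos hN']
      simp
    have := h hd
    rw [Real.dist_eq, hself, sub_self, superNorm_zero, sub_zero] at this
    exact (le_abs_self _).trans_lt this
  · rw [hprod]
    congr 1
    · simp [p, Set.projIcc_left]
    · simp only [p]
      push_cast
      rw [div_self hN'.ne', Set.projIcc_right]
      rfl

theorem IsPTP.exists_det_eq_ofReal {E : Superoperator (Fin 2)} (hE : IsPTP E) :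
    ∃ r : ℝ, LinearMap.det E = r := by
  obtain ⟨t, D, rfl⟩ := hE.exists_eq_blochMap
  exact ⟨_, det_blochMap t D⟩

/-- Each factor can be taken so close to the identity that its real determinant differs from 1 by
less than 1. -/
theorem IsPTPDivisible.exists_det_eq_ofReal_pos {E : Superoperator (Fin 2)}
    (hE : IsPTPDivisible E) : ∃ r : ℝ, 0 < r ∧ LinearMap.det E = r := by
  obtain ⟨δ, hδ, h⟩ := exists_superNorm_sub_lt_imp_det_sub_lt (1 : Superoperator (Fin 2)) one_pos
  obtain ⟨l, hl, rfl⟩ := hE δ hδ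
  clear hE
  induction l with
  | nil => exact ⟨1, one_pos, by simp⟩
  | cons F l ih =>
    obtain ⟨r, hr, hr'⟩ := ih fun G hG => hl G (List.mem_cons_of_mem _ hG)
    obtain ⟨hF, hF'⟩ := hl F List.mem_cons_self
    obtain ⟨s, hs⟩ := hF.exists_det_eq_ofReal
    have := h F hF'
    rw [hs, map_one, ← Complex.ofReal_one, ← Complex.ofReal_sub, Complex.norm_real,
      Real.norm_eq_abs, abs_lt] at this
    refine ⟨s * r, mul_pos (by linarith [this.1]) hr, ?_⟩
    rw [List.prod_cons, map_mul, hs, hr', Complex.ofReal_mul]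

theorem not_det_neg_of_mem_pInfinitesimalDivisible {E : Superoperator (Fin 2)}
    (hE : E ∈ pInfinitesimalDivisible (Fin 2)) : ¬ LinearMap.det E < 0 := by
  intro hneg
  rw [Complex.lt_def] at hneg
  obtain ⟨δ, hδ, h⟩ := exists_superNorm_sub_lt_imp_det_sub_lt E (neg_pos.mpr hneg.1)
  obtain ⟨F, hF, hFE⟩ := hE.2 δ hδ
  obtain ⟨r, hr, hr'⟩ := IsPTPDivisible.exists_det_eq_ofReal_pos hF.2
  have h1 := (Complex.abs_re_le_norm _).trans_lt (h F hFE)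
  rw [hr', Complex.sub_re, Complex.ofReal_re] at h1
  have h2 := (abs_lt.mp h1).2
  linarith

/-! ### Rotations -/

/-- The rotation by `θ` about the third axis. -/
noncomputable def rotZ (θ : ℝ) : Matrix (Fin 3) (Fin 3) ℝ :=
  !![Real.cos θ, -Real.sin θ, 0; Real.sin θ, Real.cos θ, 0; 0, 0, 1]

/-- The rotation by `θ` about the first axis. -/
noncomputable def rotX (θ : ℝ) : Matrix (Fin 3) (Fin 3) ℝ :=
  !![1, 0, 0; 0, Real.cos θ, -Real.sin θ; 0, Real.sin θ, Real.cos θ]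

theorem rotZ_zero : rotZ 0 = 1 := by
  ext i j; fin_cases i <;> fin_cases j <;> simp [rotZ]

theorem rotX_zero : rotX 0 = 1 := by
  ext i j; fin_cases i <;> fin_cases j <;> simp [rotX]

theorem rotZ_mul (a b : ℝ) : rotZ a * rotZ b = rotZ (a + b) := by
  ext i j
  fin_cases i <;> fin_cases j <;>
    simp [rotZ, Matrix.mul_apply, Fin.sum_univ_three, Real.cos_add, Real.sin_add] <;> ring

theorem rotX_mul (a b : ℝ) : rotX a * rotX b = rotX (a + b) := by
  ext i j
  fin_cases i <;> fin_cases j <;>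
    simp [rotX, Matrix.mul_apply, Fin.sum_univ_three, Real.cos_add, Real.sin_add] <;> ring

theorem transpose_rotZ (a : ℝ) : (rotZ a)ᵀ = rotZ (-a) := by
  ext i j; fin_cases i <;> fin_cases j <;> simp [rotZ]

theorem transpose_rotX (a : ℝ) : (rotX a)ᵀ = rotX (-a) := by
  ext i j; fin_cases i <;> fin_cases j <;> simp [rotX]

theorem det_rotZ (a : ℝ) : (rotZ a).det = 1 := by
  simp [rotZ, Matrix.det_fin_three]
  linear_combination Real.cos_sq_add_sin_sq a

theorem det_rotX (a : ℝ) : (rotX a).det = 1 := by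
  simp [rotX, Matrix.det_fin_three]
  linear_combination Real.cos_sq_add_sin_sq a

theorem continuous_rotZ : Continuous rotZ := by
  refine continuous_matrix fun i j => ?_
  fin_cases i <;> fin_cases j <;> simp [rotZ] <;> fun_prop

theorem continuous_rotX : Continuous rotX := by
  refine continuous_matrix fun i j => ?_
  fin_cases i <;> fin_cases j <;> simp [rotX] <;> fun_prop

theorem exists_polar (x y : ℝ) :
    ∃ θ : ℝ, x = √(x ^ 2 + y ^ 2) * Real.cos θ ∧ y = √(x ^ 2 + y ^ 2) * Real.sin θ := by
  have h : ‖(⟨x, y⟩ : ℂ)‖ = √(x ^ 2 + y ^ 2) := by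
    rw [Complex.norm_def, Complex.normSq_apply]; congr 1; ring
  refine ⟨Complex.arg ⟨x, y⟩, ?_, ?_⟩
  · rw [← h, Complex.norm_mul_cos_arg]
  · rw [← h, Complex.norm_mul_sin_arg]

/-- Euler angles. -/
theorem exists_eq_rotZ_mul_rotX_mul_rotZ {R : Matrix (Fin 3) (Fin 3) ℝ} (hR : Rᵀ * R = 1)
    (hdet : R.det = 1) : ∃ a b c, R = rotZ a * rotX b * rotZ c := by
  -- rotate the last column into the plane of the last two axes
  obtain ⟨a, ha⟩ : ∃ a, (rotZ a * R) 0 2 = 0 := by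
    obtain ⟨θ, h1, h2⟩ := exists_polar (R 1 2) (R 0 2)
    refine ⟨θ, ?_⟩
    simp only [rotZ, Matrix.mul_apply, Fin.sum_univ_three]
    simp
    linear_combination Real.cos θ * h2 - Real.sin θ * h1
  have horth (S : Matrix (Fin 3) (Fin 3) ℝ) (hS : Sᵀ * S = 1) (i j : Fin 3) :
      S 0 i * S 0 j + S 1 i * S 1 j + S 2 i * S 2 j = if i = j then 1 else 0 := by
    have := congrFun (congrFun hS i) j
    rwa [Matrix.mul_apply, Fin.sum_univ_three, Matrix.one_apply] at this
  have hZ (a : ℝ) (S : Matrix (Fin 3) (Fin 3) ℝ) (hS : Sᵀ * S = 1) :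
      (rotZ a * S)ᵀ * (rotZ a * S) = 1 := by
    rw [Matrix.transpose_mul, Matrix.mul_assoc, ← Matrix.mul_assoc (rotZ a)ᵀ, transpose_rotZ,
      rotZ_mul, neg_add_cancel, rotZ_zero, Matrix.one_mul, hS]
  have hX (a : ℝ) (S : Matrix (Fin 3) (Fin 3) ℝ) (hS : Sᵀ * S = 1) :
      (rotX a * S)ᵀ * (rotX a * S) = 1 := by
    rw [Matrix.transpose_mul, Matrix.mul_assoc, ← Matrix.mul_assoc (rotX a)ᵀ, transpose_rotX,
      rotX_mul, neg_add_cancel, rotX_zero, Matrix.one_mul, hS]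
  have hS := hZ a R hR
  obtain ⟨b, hb⟩ : ∃ b, (rotX b * (rotZ a * R)) 1 2 = 0 ∧
      (rotX b * (rotZ a * R)) 2 2 = 1 ∧ (rotX b * (rotZ a * R)) 0 2 = 0 := by
    generalize rotZ a * R = S at ha hS
    obtain ⟨θ, h1, h2⟩ := exists_polar (S 2 2) (S 1 2)
    have h3 := horth S hS 2 2
    rw [ha, if_pos rfl] at h3
    have h4 : S 2 2 ^ 2 + S 1 2 ^ 2 = 1 := by linear_combination h3
    rw [h4, Real.sqrt_one, one_mul] at h1 h2
    refine ⟨θ, ?_, ?_, ?_⟩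
    · simp only [rotX, Matrix.mul_apply, Fin.sum_univ_three]
      simp
      linear_combination Real.cos θ * h2 - Real.sin θ * h1
    · simp only [rotX, Matrix.mul_apply, Fin.sum_univ_three]
      simp
      linear_combination Real.sin θ * h2 + Real.cos θ * h1 + Real.cos_sq_add_sin_sq θ
    · simp only [rotX, Matrix.mul_apply, Fin.sum_univ_three]
      simp [ha]
  have hT := hX b _ hS
  have hdT : (rotX b * (rotZ a * R)).det = 1 := by
    rw [Matrix.det_mul, Matrix.det_mul, det_rotX, det_rotZ, hdet]; norm_num
  obtain ⟨c, hc⟩ : ∃ c, rotX b * (rotZ a * R) = rotZ c := by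
    generalize rotX b * (rotZ a * R) = T at hb hT hdT
    obtain ⟨h12, h22, h02⟩ := hb
    have h20 : T 2 0 = 0 := by
      have := horth T hT 0 2
      simpa [h12, h22, h02] using this
    have h21 : T 2 1 = 0 := by
      have := horth T hT 1 2
      simpa [h12, h22, h02] using this
    have h00 := horth T hT 0 0
    have h01 := horth T hT 0 1
    have h11 := horth T hT 1 1
    simp [h20, h21] at h00 h01 h11
    rw [Matrix.det_fin_three] at hdT
    simp [h20, h21, h22, h02, h12] at hdT
    obtain ⟨θ, h1, h2⟩ := exists_polar (T 0 0) (T 1 0)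
    have h4 : T 0 0 ^ 2 + T 1 0 ^ 2 = 1 := by linear_combination h00
    rw [h4, Real.sqrt_one, one_mul] at h1 h2
    -- The upper 2 × 2 block is orthogonal of determinant 1, so it equals its own cofactor matrix.
    have h5 : T 1 1 = T 0 0 := by
      linear_combination T 0 0 * hdT - T 1 1 * h00 + T 1 0 * h01
    have h6 : T 0 1 = -T 1 0 := by
      linear_combination -T 1 0 * hdT - T 0 1 * h00 + T 0 0 * h01
    refine ⟨θ, ?_⟩
    ext i j
    fin_cases i <;> fin_cases j <;> simp [rotZ, h20, h21, h22, h02, h12, h5, h6, h1, h2]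
  refine ⟨-a, -b, c, ?_⟩
  rw [← hc, Matrix.mul_assoc, ← Matrix.mul_assoc (rotX (-b)), rotX_mul, neg_add_cancel, rotX_zero,
    Matrix.one_mul, ← Matrix.mul_assoc, rotZ_mul, neg_add_cancel, rotZ_zero, Matrix.one_mul]

theorem isPTP_blochMap_zero_of_orthogonal {R : Matrix (Fin 3) (Fin 3) ℝ} (hR : Rᵀ * R = 1) :
    IsPTP (blochMap 0 R) := by
  rw [isPTP_blochMap]
  intro x hx
  rw [zero_add, Matrix.dotProduct_mulVec, ← Matrix.mulVec_transpose, Matrix.mulVec_mulVec, hR,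
    Matrix.one_mulVec]
  exact hx

/-- The subgroup itself is the path: the step from r to s is G((s - r) θ), which is orthogonal. -/
theorem isPTPDivisible_of_oneParameterGroup {G : ℝ → Matrix (Fin 3) (Fin 3) ℝ}
    (hG : Continuous G) (hG0 : G 0 = 1) (hmul : ∀ a b, G a * G b = G (a + b))
    (hT : ∀ a, (G a)ᵀ = G (-a)) (θ : ℝ) : IsPTPDivisible (blochMap 0 (G θ)) := by
  have key := isPTPDivisible_of_path
    (fun r s : unitInterval => blochMap 0 (G (((s : ℝ) - r) * θ))) ?_ ?_ ?_ ?_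
  · simpa using key
  · intro r s u _ _
    rw [blochMap_mul, hmul]
    congr 1
    · simp
    · congr 1; ring
  · intro r
    simp [hG0, blochMap_one]
  · refine continuous_superNorm_blochMap_sub (t := fun _ => 0) continuous_const ?_ 1
    exact hG.comp (by fun_prop)
  · intro r s _
    refine isPTP_blochMap_zero_of_orthogonal ?_
    rw [hT, hmul, neg_add_cancel, hG0]

theorem isPTPDivisible_blochMap_of_rotation {R : Matrix (Fin 3) (Fin 3) ℝ} (hR : Rᵀ * R = 1)
    (hdet : R.det = 1) : IsPTPDivisible (blochMap 0 R) := by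
  obtain ⟨a, b, c, rfl⟩ := exists_eq_rotZ_mul_rotX_mul_rotZ hR hdet
  have hz := isPTPDivisible_of_oneParameterGroup continuous_rotZ rotZ_zero rotZ_mul transpose_rotZ
  have hx := isPTPDivisible_of_oneParameterGroup continuous_rotX rotX_zero rotX_mul transpose_rotX
  simpa [blochMap_mul] using ((hz a).mul (hx b)).mul (hz c)

/-! ### Support functions and shrinking ellipsoids -/

/-- The Euclidean norm. -/
noncomputable def euclid (x : Fin 3 → ℝ) : ℝ := √(x ⬝ᵥ x)

theorem euclid_nonneg (x : Fin 3 → ℝ) : 0 ≤ euclid x := Real.sqrt_nonneg _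

theorem euclid_sq (x : Fin 3 → ℝ) : euclid x ^ 2 = x ⬝ᵥ x :=
  Real.sq_sqrt (dotProduct_self_nonneg x)

theorem euclid_le_one_iff {x : Fin 3 → ℝ} : euclid x ≤ 1 ↔ x ⬝ᵥ x ≤ 1 := by
  rw [euclid, Real.sqrt_le_one]

theorem euclid_neg (x : Fin 3 → ℝ) : euclid (-x) = euclid x := by
  simp [euclid]

theorem abs_dotProduct_le (x y : Fin 3 → ℝ) : |x ⬝ᵥ y| ≤ euclid x * euclid y := by
  rw [euclid, euclid, ← Real.sqrt_mul (dotProduct_self_nonneg x)]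
  refine Real.abs_le_sqrt ?_
  have := Finset.sum_mul_sq_le_sq_mul_sq Finset.univ x y
  simpa only [dotProduct, sq] using this

theorem dotProduct_le (x y : Fin 3 → ℝ) : x ⬝ᵥ y ≤ euclid x * euclid y :=
  (le_abs_self _).trans (abs_dotProduct_le x y)

/-- Containment of an ellipsoid in the unit ball in terms of support functions. -/
theorem isPTP_blochMap_iff_support {t : Fin 3 → ℝ} {D : Matrix (Fin 3) (Fin 3) ℝ} :
    IsPTP (blochMap t D) ↔ ∀ w, t ⬝ᵥ w + euclid (Dᵀ *ᵥ w) ≤ euclid w := by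
  have adj (x w : Fin 3 → ℝ) : (D *ᵥ x) ⬝ᵥ w = x ⬝ᵥ (Dᵀ *ᵥ w) := by
    rw [Matrix.mulVec_transpose, dotProduct_comm, Matrix.dotProduct_mulVec, dotProduct_comm]
  rw [isPTP_blochMap]
  constructor
  · intro h w
    set u := Dᵀ *ᵥ w with hu
    -- The maximizer of x ↦ x · u on the ball is u / |u|; for u = 0 the convention 0⁻¹ = 0 selects
    -- the centre, which serves as well.
    have h1 : (euclid u)⁻¹ • u ⬝ᵥ u = euclid u := by
      rw [smul_dotProduct, ← euclid_sq, smul_eq_mul]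
      rcases eq_or_ne (euclid u) 0 with h0 | h0
      · simp [h0]
      · field_simp
    have h2 : ((euclid u)⁻¹ • u) ⬝ᵥ ((euclid u)⁻¹ • u) ≤ 1 := by
      rw [dotProduct_smul, h1, smul_eq_mul]
      exact inv_mul_le_one
    have h3 := dotProduct_le (t + D *ᵥ ((euclid u)⁻¹ • u)) w
    rw [add_dotProduct, adj, ← hu, h1] at h3
    exact h3.trans (mul_le_of_le_one_left (euclid_nonneg w) (euclid_le_one_iff.mpr (h _ h2)))
  · intro h x hx
    rw [← euclid_le_one_iff]
    -- Testing in the direction of the image point v itself gives |v|² ≤ |v|.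
    set v := t + D *ᵥ x with hv
    have h1 : v ⬝ᵥ v ≤ euclid v := by
      refine le_trans ?_ (h v)
      conv_lhs => rw [hv, add_dotProduct, ← hv, adj]
      gcongr
      exact (dotProduct_le _ _).trans
        (mul_le_of_le_one_left (euclid_nonneg _) (euclid_le_one_iff.mpr hx))
    rw [← euclid_sq] at h1
    by_contra! h2
    nlinarith

/-- The Cholesky factor of a positive definite matrix. -/
noncomputable def cholesky (A : Matrix (Fin 3) (Fin 3) ℝ) : Matrix (Fin 3) (Fin 3) ℝ :=
  !![√(A 0 0), 0, 0;
    A 0 1 / √(A 0 0), √(A 0 0 * A 1 1 - A 0 1 ^ 2) / √(A 0 0), 0;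
    A 0 2 / √(A 0 0),
    (A 0 0 * A 1 2 - A 0 1 * A 0 2) / (√(A 0 0) * √(A 0 0 * A 1 1 - A 0 1 ^ 2)),
    √A.det / √(A 0 0 * A 1 1 - A 0 1 ^ 2)]

theorem minor_pos {A : Matrix (Fin 3) (Fin 3) ℝ} (hA : A.PosDef) :
    0 < A 0 0 * A 1 1 - A 0 1 ^ 2 := by
  have h := (hA.submatrix (e := (![0, 1] : Fin 2 → Fin 3)) (by decide)).det_pos
  rw [Matrix.det_fin_two] at h
  have h1 : A 1 0 = A 0 1 := hA.isHermitian.apply 0 1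
  simp [h1] at h
  nlinarith

theorem cholesky_mul_transpose {A : Matrix (Fin 3) (Fin 3) ℝ} (hA : A.PosDef) :
    cholesky A * (cholesky A)ᵀ = A := by
  have h0 : 0 < A 0 0 := hA.diag_pos
  have hm := minor_pos hA
  have hd := hA.det_pos
  have h1 : A 1 0 = A 0 1 := hA.isHermitian.apply 0 1
  have h2 : A 2 0 = A 0 2 := hA.isHermitian.apply 0 2
  have h3 : A 2 1 = A 1 2 := hA.isHermitian.apply 1 2
  have hp := Real.sq_sqrt h0.le
  have hq := Real.sq_sqrt hm.le
  have hr := Real.sq_sqrt hd.le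
  have hp0 := Real.sqrt_pos.mpr h0
  have hq0 := Real.sqrt_pos.mpr hm
  have hdet : A.det = A 0 0 * (A 1 1 * A 2 2 - A 1 2 ^ 2) - A 0 1 * (A 0 1 * A 2 2 - A 1 2 * A 0 2)
      + A 0 2 * (A 0 1 * A 1 2 - A 1 1 * A 0 2) := by
    rw [Matrix.det_fin_three, h1, h2, h3]; ring
  have e00 : √(A 0 0) * √(A 0 0) = A 0 0 := by rw [← sq, hp]
  have e11 : A 0 1 / √(A 0 0) * (A 0 1 / √(A 0 0)) + √(A 0 0 * A 1 1 - A 0 1 ^ 2) / √(A 0 0) *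
      (√(A 0 0 * A 1 1 - A 0 1 ^ 2) / √(A 0 0)) = A 1 1 := by
    rw [div_mul_div_comm, div_mul_div_comm, ← sq, ← sq, ← sq, hp, hq]
    field_simp
    ring
  have e12 : A 0 1 / √(A 0 0) * (A 0 2 / √(A 0 0)) + √(A 0 0 * A 1 1 - A 0 1 ^ 2) / √(A 0 0) *
      ((A 0 0 * A 1 2 - A 0 1 * A 0 2) / (√(A 0 0) * √(A 0 0 * A 1 1 - A 0 1 ^ 2))) = A 1 2 := by
    generalize √(A 0 0 * A 1 1 - A 0 1 ^ 2) = q at *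
    field_simp
    rw [hp]
    ring
  have e22 : A 0 2 / √(A 0 0) * (A 0 2 / √(A 0 0)) +
      (A 0 0 * A 1 2 - A 0 1 * A 0 2) / (√(A 0 0) * √(A 0 0 * A 1 1 - A 0 1 ^ 2)) *
      ((A 0 0 * A 1 2 - A 0 1 * A 0 2) / (√(A 0 0) * √(A 0 0 * A 1 1 - A 0 1 ^ 2))) +
      √A.det / √(A 0 0 * A 1 1 - A 0 1 ^ 2) * (√A.det / √(A 0 0 * A 1 1 - A 0 1 ^ 2)) = A 2 2 := by
    simp only [← sq, div_pow, mul_pow, hp, hq, hr]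
    obtain ⟨m, hm'⟩ : ∃ m, m = A 0 0 * A 1 1 - A 0 1 ^ 2 := ⟨_, rfl⟩
    rw [hdet, ← hm']
    rw [← hm'] at hm
    field_simp
    rw [hm']
    ring
  ext i j
  fin_cases i <;> fin_cases j <;>
    simp [cholesky, Matrix.mul_apply, Fin.sum_univ_three]
  · exact e00
  · field_simp
  · field_simp
  · rw [h1]; field_simp
  · exact e11
  · exact e12
  · rw [h2]; field_simp
  · rw [h3]; linear_combination e12
  · exact e22

theorem det_cholesky {A : Matrix (Fin 3) (Fin 3) ℝ} (hA : A.PosDef) : 0 < (cholesky A).det := by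
  have h0 : 0 < A 0 0 := hA.diag_pos
  have hm := minor_pos hA
  have hd := hA.det_pos
  rw [Matrix.det_fin_three]
  simp [cholesky]
  positivity

theorem cholesky_one : cholesky 1 = 1 := by
  ext i j
  fin_cases i <;> fin_cases j <;> simp [cholesky]

theorem continuous_cholesky {α : Type*} [TopologicalSpace α]
    {A : α → Matrix (Fin 3) (Fin 3) ℝ} (hA : Continuous A) (hpos : ∀ a, (A a).PosDef) :
    Continuous fun a => cholesky (A a) := by
  have h (i j : Fin 3) : Continuous fun a => A a i j := hA.matrix_elem i j
  have hdet : Continuous fun a => (A a).det := hA.matrix_det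
  have h0 (a : α) : √(A a 0 0) ≠ 0 := (Real.sqrt_pos.mpr (hpos a).diag_pos).ne'
  have hm (a : α) : √(A a 0 0 * A a 1 1 - A a 0 1 ^ 2) ≠ 0 :=
    (Real.sqrt_pos.mpr (minor_pos (hpos a))).ne'
  have hc0 : Continuous fun a => √(A a 0 0) := by fun_prop
  have hcm : Continuous fun a => √(A a 0 0 * A a 1 1 - A a 0 1 ^ 2) := by fun_prop
  refine continuous_matrix fun i j => ?_
  fin_cases i <;> fin_cases j <;> simp [cholesky]
  · exact hc0
  · exact continuous_const
  · exact continuous_const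
  · exact (h 0 1).div hc0 h0
  · exact hcm.div hc0 h0
  · exact continuous_const
  · exact (h 0 2).div hc0 h0
  · exact (((h 0 0).mul (h 1 2)).sub ((h 0 1).mul (h 0 2))).div (hc0.mul hcm)
      fun a => mul_ne_zero (h0 a) (hm a)
  · exact hdet.sqrt.div hcm hm

/-- Monotonicity of the support functions of the interpolating ellipsoids. -/
theorem support_interpolation_antitone {a b τ r s : ℝ} (ha : 0 ≤ a) (hab : a + |τ| ≤ b)
    (hr : 0 ≤ r) (hrs : r ≤ s) (hs : s ≤ 1) :
    (s - r) * τ + √((1 - s) * b ^ 2 - s * (1 - s) * τ ^ 2 + s * a ^ 2) ≤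
      √((1 - r) * b ^ 2 - r * (1 - r) * τ ^ 2 + r * a ^ 2) := by
  rcases hrs.eq_or_lt with rfl | hrs'
  · simp
  have hs0 : 0 < s := hr.trans_lt hrs'
  have hb : 0 ≤ b := by linarith [abs_nonneg τ]
  have hτb : τ ^ 2 ≤ b ^ 2 := by
    rw [sq_le_sq, abs_of_nonneg hb]; linarith
  have hf : 0 ≤ (1 - s) * b ^ 2 - s * (1 - s) * τ ^ 2 + s * a ^ 2 := by
    have : 0 ≤ (1 - s) * (b ^ 2 - s * τ ^ 2) :=
      mul_nonneg (by linarith) (by nlinarith [sq_nonneg τ])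
    nlinarith [mul_nonneg hs0.le (sq_nonneg a)]
  set g := √((1 - s) * b ^ 2 - s * (1 - s) * τ ^ 2 + s * a ^ 2) with hg
  have hg2 : g ^ 2 = (1 - s) * b ^ 2 - s * (1 - s) * τ ^ 2 + s * a ^ 2 := Real.sq_sqrt hf
  -- z is the support function at parameter s. Completing the square shows that it is a root of the
  -- convex combination of z² - b² and (z - τ)² - a² with weights 1 - s and s; this dictates the
  -- term s(1-s)τ² in the interpolation.
  obtain ⟨z, hz⟩ : ∃ z, z = s * τ + g := ⟨_, rfl⟩
  have hroot : (1 - s) * (z ^ 2 - b ^ 2) + s * ((z - τ) ^ 2 - a ^ 2) = 0 := by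
    rw [hz]; linear_combination hg2
  -- If z² > b², the second bracket is nonpositive, so |z| ≤ a + |τ| ≤ b, a contradiction.
  have hp : z ^ 2 - b ^ 2 ≤ 0 := by
    by_contra! hp
    have h1 : (z - τ) ^ 2 - a ^ 2 ≤ 0 := by
      by_contra! h1
      have := mul_pos hs0 h1
      have := mul_nonneg (sub_nonneg.mpr hs) hp.le
      linarith
    have h2 : |z - τ| ≤ a := abs_le_of_sq_le_sq (by linarith) ha
    have h3 : |z| ≤ b := by
      calc |z| = |z - τ + τ| := by ring_nf
        _ ≤ |z - τ| + |τ| := abs_add_le _ _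
        _ ≤ b := by linarith
    have h4 : z ^ 2 ≤ b ^ 2 := sq_le_sq' (abs_le.mp h3).1 (abs_le.mp h3).2
    linarith
  have hq : 0 ≤ (z - τ) ^ 2 - a ^ 2 := by
    by_contra! hq
    have := mul_neg_of_pos_of_neg hs0 hq
    have := mul_nonpos_of_nonneg_of_nonpos (sub_nonneg.mpr hs) hp
    linarith
  -- The brackets have signs ≤ 0 and ≥ 0, so moving weight from the second to the first (r ≤ s)
  -- keeps the combination nonpositive.
  have hfin : (z - r * τ) ^ 2 ≤ (1 - r) * b ^ 2 - r * (1 - r) * τ ^ 2 + r * a ^ 2 := by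
    have h1 := mul_nonneg (sub_nonneg.mpr hrs) hq
    have h2 := mul_nonpos_of_nonneg_of_nonpos (sub_nonneg.mpr hrs) hp
    linarith
  have : (s - r) * τ + g = z - r * τ := by rw [hz]; ring
  rw [this]
  exact Real.le_sqrt_of_sq_le hfin

/-- The squared semi-axes matrix of the ellipsoids interpolating between the unit ball and its
image under `x ↦ t + D x`. -/
noncomputable def interpolation (t : Fin 3 → ℝ) (D : Matrix (Fin 3) (Fin 3) ℝ) (s : ℝ) :
    Matrix (Fin 3) (Fin 3) ℝ :=
  (1 - s) • 1 - (s * (1 - s)) • vecMulVec t t + s • (D * Dᵀ)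

theorem dotProduct_mul_transpose_mulVec (L : Matrix (Fin 3) (Fin 3) ℝ) (w : Fin 3 → ℝ) :
    w ⬝ᵥ ((L * Lᵀ) *ᵥ w) = euclid (Lᵀ *ᵥ w) ^ 2 := by
  rw [euclid_sq, ← Matrix.mulVec_mulVec, Matrix.dotProduct_mulVec, ← Matrix.mulVec_transpose]

theorem dotProduct_interpolation_mulVec (t : Fin 3 → ℝ) (D : Matrix (Fin 3) (Fin 3) ℝ) (s : ℝ)
    (w : Fin 3 → ℝ) : w ⬝ᵥ (interpolation t D s *ᵥ w) =
      (1 - s) * euclid w ^ 2 - s * (1 - s) * (t ⬝ᵥ w) ^ 2 + s * euclid (Dᵀ *ᵥ w) ^ 2 := by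
  have h : w ⬝ᵥ (vecMulVec t t *ᵥ w) = (t ⬝ᵥ w) ^ 2 := by
    simp only [dotProduct, Matrix.mulVec, vecMulVec_apply, Fin.sum_univ_three]
    ring
  rw [interpolation, Matrix.add_mulVec, Matrix.sub_mulVec, Matrix.smul_mulVec,
    Matrix.smul_mulVec, Matrix.smul_mulVec, dotProduct_add, dotProduct_sub, dotProduct_smul,
    dotProduct_smul, dotProduct_smul, h, Matrix.one_mulVec, dotProduct_mul_transpose_mulVec,
    euclid_sq w]
  simp only [smul_eq_mul]

theorem support_abs_le {t : Fin 3 → ℝ} {D : Matrix (Fin 3) (Fin 3) ℝ}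
    (h : IsPTP (blochMap t D)) (w : Fin 3 → ℝ) :
    euclid (Dᵀ *ᵥ w) + |t ⬝ᵥ w| ≤ euclid w := by
  rw [isPTP_blochMap_iff_support] at h
  have h1 := h w
  have h2 := h (-w)
  rw [dotProduct_neg, Matrix.mulVec_neg, euclid_neg, euclid_neg] at h2
  rcases abs_cases (t ⬝ᵥ w) with ⟨h3, -⟩ | ⟨h3, -⟩ <;> rw [h3] <;> linarith

theorem euclid_pos {x : Fin 3 → ℝ} (hx : x ≠ 0) : 0 < euclid x := by
  refine Real.sqrt_pos.mpr ((dotProduct_self_nonneg x).lt_of_ne' ?_)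
  rwa [Ne, dotProduct_self_eq_zero]

theorem posDef_interpolation {t : Fin 3 → ℝ} {D : Matrix (Fin 3) (Fin 3) ℝ}
    (h : IsPTP (blochMap t D)) (hD : D.det ≠ 0) {s : ℝ} (hs0 : 0 ≤ s) (hs1 : s ≤ 1) :
    (interpolation t D s).PosDef := by
  refine Matrix.PosDef.of_dotProduct_mulVec_pos ?_ ?_
  · rw [Matrix.IsHermitian, Matrix.conjTranspose_eq_transpose_of_trivial, interpolation]
    simp [Matrix.transpose_mul, Matrix.transpose_vecMulVec]
  · intro w hw
    rw [star_trivial, dotProduct_interpolation_mulVec]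
    have h1 := support_abs_le h w
    have hb := euclid_pos hw
    have ha : 0 < euclid (Dᵀ *ᵥ w) := by
      refine euclid_pos fun h0 => hw ?_
      refine Matrix.eq_zero_of_mulVec_eq_zero ?_ h0
      rwa [Matrix.det_transpose]
    have hτ : (t ⬝ᵥ w) ^ 2 ≤ euclid w ^ 2 := by
      rw [sq_le_sq, abs_of_pos hb]; linarith
    -- The quadratic form splits as (1-s)²|w|² + s(1-s)(|w|² - (t·w)²) + s|Dᵀw|².
    have h2 : 0 ≤ (1 - s) * s * (euclid w ^ 2 - (t ⬝ᵥ w) ^ 2) :=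
      mul_nonneg (mul_nonneg (by linarith) hs0) (by linarith)
    rcases hs0.eq_or_lt with rfl | hs0
    · simp only [sub_zero, one_mul, zero_mul, add_zero]
      positivity
    · have h3 : 0 < s * euclid (Dᵀ *ᵥ w) ^ 2 := by positivity
      have h4 : 0 ≤ (1 - s) * (1 - s) * euclid w ^ 2 := by positivity [sub_nonneg.mpr hs1]
      linarith

/-- The Cholesky factor is a square root that depends continuously on the shape matrix and equals 1
at 1, so it parametrizes the nested ellipsoids by a continuous path from the identity. -/
theorem isPTPDivisible_blochMap_cholesky {t : Fin 3 → ℝ} {D : Matrix (Fin 3) (Fin 3) ℝ}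
    (h : IsPTP (blochMap t D)) (hD : D.det ≠ 0) :
    IsPTPDivisible (blochMap t (cholesky (D * Dᵀ))) := by
  let A : unitInterval → Matrix (Fin 3) (Fin 3) ℝ := fun s => interpolation t D s
  have hA (s : unitInterval) : (A s).PosDef := posDef_interpolation h hD s.2.1 s.2.2
  have hAc : Continuous A := by
    simp only [A, interpolation]
    fun_prop
  let L : unitInterval → Matrix (Fin 3) (Fin 3) ℝ := fun s => cholesky (A s)
  have hL (s : unitInterval) : IsUnit (L s).det := (det_cholesky (hA s)).ne'.isUnit
  have hLc : Continuous L := continuous_cholesky hAc hA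
  have hLi : Continuous fun s => (L s)⁻¹ := by
    simp only [Matrix.inv_def, Ring.inverse_eq_inv']
    exact (hLc.matrix_det.inv₀ fun s => (hL s).ne_zero).smul hLc.matrix_adjugate
  -- With φ_s(x) = s t + L_s x, the step is φ_r⁻¹ ∘ φ_s. It preserves the ball because the ellipsoid
  -- at s lies inside the one at r.
  have key := isPTPDivisible_of_path
    (fun r s : unitInterval => blochMap ((L r)⁻¹ *ᵥ (((s : ℝ) - r) • t)) ((L r)⁻¹ * L s))
    ?_ ?_ ?_ ?_
  · have h0 : L 0 = 1 := by
      have : A 0 = 1 := by simp [A, interpolation]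
      simp only [L, this, cholesky_one]
    have h1 : A 1 = D * Dᵀ := by simp [A, interpolation]
    simp only [h0] at key
    simpa [L, h1] using key
  · intro r s u _ _
    rw [blochMap_mul]
    congr 1
    · rw [Matrix.mulVec_mulVec, Matrix.mul_assoc, Matrix.mul_nonsing_inv _ (hL s), Matrix.mul_one,
        ← Matrix.mulVec_add, ← add_smul]
      congr 2
      ring
    · rw [Matrix.mul_assoc, ← Matrix.mul_assoc (L s), Matrix.mul_nonsing_inv _ (hL s),
        Matrix.one_mul]
  · intro r
    rw [sub_self, zero_smul, Matrix.mulVec_zero, Matrix.nonsing_inv_mul _ (hL r), blochMap_one]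
  · refine continuous_superNorm_blochMap_sub ?_ ?_ 1
    · exact (hLi.comp continuous_fst).matrix_mulVec (by fun_prop)
    · exact (hLi.comp continuous_fst).matrix_mul (hLc.comp continuous_snd)
  · intro r s hrs
    rw [isPTP_blochMap_iff_support]
    intro u
    -- Pulling the test direction back through L_r turns the ball condition into a comparison of the
    -- two ellipsoids' support functions at w.
    obtain ⟨w, rfl⟩ : ∃ w, u = (L r)ᵀ *ᵥ w := by
      refine ⟨(L r)ᵀ⁻¹ *ᵥ u, ?_⟩
      rw [Matrix.mulVec_mulVec, Matrix.mul_nonsing_inv, Matrix.one_mulVec]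
      rw [Matrix.det_transpose]
      exact hL r
    have e1 : ((L r)⁻¹ *ᵥ (((s : ℝ) - r) • t)) ⬝ᵥ ((L r)ᵀ *ᵥ w) = ((s : ℝ) - r) * (t ⬝ᵥ w) := by
      rw [Matrix.mulVec_transpose, dotProduct_comm, ← Matrix.dotProduct_mulVec,
        Matrix.mulVec_mulVec, Matrix.mul_nonsing_inv _ (hL r), Matrix.one_mulVec,
        dotProduct_smul, smul_eq_mul, dotProduct_comm]
    have e2 : ((L r)⁻¹ * L s)ᵀ *ᵥ ((L r)ᵀ *ᵥ w) = (L s)ᵀ *ᵥ w := by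
      rw [Matrix.mulVec_mulVec, ← Matrix.transpose_mul, ← Matrix.mul_assoc,
        Matrix.mul_nonsing_inv _ (hL r), Matrix.one_mul]
    have e3 (q : unitInterval) : euclid ((L q)ᵀ *ᵥ w) =
        √((1 - q) * euclid w ^ 2 - q * (1 - q) * (t ⬝ᵥ w) ^ 2 + q * euclid (Dᵀ *ᵥ w) ^ 2) := by
      rw [← dotProduct_interpolation_mulVec]
      change _ = √(w ⬝ᵥ A q *ᵥ w)
      rw [← cholesky_mul_transpose (hA q), dotProduct_mul_transpose_mulVec,
        Real.sqrt_sq (euclid_nonneg _)]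
    rw [e1, e2, e3, e3]
    exact support_interpolation_antitone (euclid_nonneg _) (support_abs_le h w) r.2.1 hrs s.2.2

/-- D = L (L⁻¹ D), where L Lᵀ = D Dᵀ makes L⁻¹ D orthogonal and det D > 0 makes it a proper
rotation. -/
theorem isPTPDivisible_of_det_pos {t : Fin 3 → ℝ} {D : Matrix (Fin 3) (Fin 3) ℝ}
    (h : IsPTP (blochMap t D)) (hD : 0 < D.det) : IsPTPDivisible (blochMap t D) := by
  have hA : (D * Dᵀ).PosDef := by
    simpa [interpolation] using posDef_interpolation h hD.ne' zero_le_one le_rfl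
  set L := cholesky (D * Dᵀ) with hLdef
  have hLpos : 0 < L.det := det_cholesky hA
  have hL : IsUnit L.det := hLpos.ne'.isUnit
  have hLL : L * Lᵀ = D * Dᵀ := cholesky_mul_transpose hA
  have hRR : (L⁻¹ * D) * (L⁻¹ * D)ᵀ = 1 := by
    rw [Matrix.transpose_mul, Matrix.mul_assoc, ← Matrix.mul_assoc D, ← hLL, Matrix.mul_assoc L,
      ← Matrix.mul_assoc L⁻¹, Matrix.nonsing_inv_mul _ hL, Matrix.one_mul, ← Matrix.transpose_mul,
      Matrix.nonsing_inv_mul _ hL, Matrix.transpose_one]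
  have hRdet : (L⁻¹ * D).det = 1 := by
    have h1 := congrArg Matrix.det hRR
    rw [Matrix.det_mul, Matrix.det_transpose, Matrix.det_one] at h1
    have h2 : 0 < (L⁻¹ * D).det := by
      rw [Matrix.det_mul, Matrix.det_nonsing_inv, Ring.inverse_eq_inv']
      positivity
    nlinarith
  have h1 := (isPTPDivisible_blochMap_cholesky h hD.ne').mul
    (isPTPDivisible_blochMap_of_rotation (mul_eq_one_comm.mp hRR) hRdet)
  rwa [blochMap_mul, Matrix.mulVec_zero, add_zero, ← Matrix.mul_assoc,
    Matrix.mul_nonsing_inv _ hL, Matrix.one_mul] at h1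

/-! ### Measure-and-prepare maps -/

/-- Measure-and-prepare (Holevo) form with outcomes indexed by `ι`. -/
def IsMeasurePrepare (ι : Type*) [Fintype ι] {n : Type*} [Fintype n] (E : Superoperator n) :
    Prop :=
  ∃ m ρ : ι → Matrix n n ℂ, (∀ k, (m k).PosSemidef) ∧ (∀ k, (ρ k).PosSemidef) ∧
    ∀ X, E X = ∑ k, (m k * X).trace • ρ k

/-- The unnormalized state of the ancilla after observing the effect `m` on the second factor. -/
def conditionalState {n : Type*} [Fintype n] {k : ℕ} (m : Matrix n n ℂ)
    (σ : Matrix (Fin k × n) (Fin k × n) ℂ) : Matrix (Fin k) (Fin k) ℂ :=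
  Matrix.of fun i j => (m * Matrix.of fun a b => σ (i, a) (j, b)).trace

/-- Decomposing m = ∑ v v†, the conditional state is ∑ W σ W† with W = 1 ⊗ v†. -/
theorem posSemidef_conditionalState {n : Type*} [Fintype n] [DecidableEq n] {k : ℕ}
    {m : Matrix n n ℂ} (hm : m.PosSemidef) {σ : Matrix (Fin k × n) (Fin k × n) ℂ}
    (hσ : σ.PosSemidef) : (conditionalState m σ).PosSemidef := by
  obtain ⟨N, v, hv⟩ := Matrix.posSemidef_iff_eq_sum_vecMulVec.mp hm
  let W : Fin N → Matrix (Fin k) (Fin k × n) ℂ := fun l =>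
    Matrix.of fun i p => if i = p.1 then star (v l p.2) else 0
  have key : conditionalState m σ = ∑ l, W l * σ * (W l)ᴴ := by
    ext i j
    rw [Matrix.sum_apply]
    simp only [conditionalState, of_apply, hv, Finset.sum_mul, Matrix.trace_sum]
    refine Finset.sum_congr rfl fun l _ => ?_
    simp only [W, Matrix.mul_apply, Matrix.trace, diag_apply, conjTranspose_apply, of_apply,
      Fintype.sum_prod_type, vecMulVec_apply, Pi.star_apply, ite_mul, zero_mul, apply_ite star,
      star_star, star_zero, mul_ite, mul_zero, Finset.sum_mul]
    simp only [Finset.sum_ite_irrel, Finset.sum_const_zero, Finset.sum_ite_eq, Finset.mem_univ,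
      if_true]
    refine Finset.sum_congr rfl fun a _ => Finset.sum_congr rfl fun b _ => ?_
    ring
  rw [key]
  exact Matrix.posSemidef_sum _ fun l _ => hσ.mul_mul_conjTranspose_same (W l)

theorem ampliation_eq_sum_conditionalState {ι n : Type*} [Fintype ι] [Fintype n]
    {E : Superoperator n} {m ρ : ι → Matrix n n ℂ}
    (hE : ∀ X, E X = ∑ k, (m k * X).trace • ρ k) (k : ℕ) (σ : Matrix (Fin k × n) (Fin k × n) ℂ) :
    ampliation k E σ = ∑ l, conditionalState (m l) σ ⊗ₖ ρ l := by
  ext x y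
  simp only [ampliation, of_apply, hE, Matrix.sum_apply, Matrix.smul_apply, smul_eq_mul,
    kroneckerMap_apply, conditionalState]

theorem IsMeasurePrepare.isChannel {ι n : Type*} [Fintype ι] [Fintype n] [DecidableEq n]
    {E : Superoperator n} (hE : IsMeasurePrepare ι E) (htp : IsTracePreserving E) :
    IsChannel E := by
  obtain ⟨m, ρ, hm, hρ, hE⟩ := hE
  refine ⟨fun k X hX => ?_, htp⟩
  rw [ampliation_eq_sum_conditionalState hE]
  exact Matrix.posSemidef_sum _ fun l _ => (posSemidef_conditionalState (hm l) hX).kronecker (hρ l)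

theorem isDensityMatrix_single {n : Type*} [Fintype n] [DecidableEq n] (i : n) :
    IsDensityMatrix (Matrix.single i i (1 : ℂ)) := by
  refine ⟨?_, Matrix.trace_single_eq_same i 1⟩
  rw [← Matrix.diagonal_single]
  exact Matrix.PosSemidef.diagonal (Pi.single_nonneg.mpr zero_le_one)

theorem exists_eq_smul_isDensityMatrix {n : Type*} [Fintype n] [DecidableEq n] [Nonempty n]
    {P : Matrix n n ℂ} (hP : P.PosSemidef) :
    ∃ (q : ℝ) (A : Matrix n n ℂ), 0 ≤ q ∧ IsDensityMatrix A ∧ P = (q : ℂ) • A := by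
  have h0 := hP.trace_nonneg
  obtain ⟨q, hq⟩ : ∃ q : ℝ, P.trace = q := ⟨P.trace.re, (Complex.eq_re_of_ofReal_le h0)⟩
  have hq0 : 0 ≤ q := by rw [hq] at h0; exact_mod_cast h0
  rcases hq0.eq_or_lt with rfl | hpos
  · obtain ⟨i⟩ := ‹Nonempty n›
    refine ⟨0, _, le_rfl, isDensityMatrix_single i, ?_⟩
    rw [Complex.ofReal_zero, zero_smul]
    exact hP.trace_eq_zero_iff.mp (by simpa using hq)
  · have hqc : (q : ℂ) ≠ 0 := by exact_mod_cast hpos.ne'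
    refine ⟨q, (q : ℂ)⁻¹ • P, hq0, ⟨hP.smul ?_, ?_⟩, ?_⟩
    · exact_mod_cast (inv_pos.mpr hpos).le
    · rw [Matrix.trace_smul, hq, smul_eq_mul, inv_mul_cancel₀ hqc]
    · rw [smul_smul, mul_inv_cancel₀ hqc, one_smul]

theorem trace_ampliation {n : Type*} [Fintype n] {E : Superoperator n}
    (hE : IsTracePreserving E) (k : ℕ) (σ : Matrix (Fin k × n) (Fin k × n) ℂ) :
    (ampliation k E σ).trace = σ.trace := by
  simp only [Matrix.trace, diag_apply, Fintype.sum_prod_type]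
  exact Finset.sum_congr rfl fun i _ => hE (Matrix.of fun a b => σ (i, a) (i, b))

/-- Each outcome leaves a product of a conditional ancilla state and a prepared state; the traces
are the probabilities. -/
theorem IsMeasurePrepare.isEntanglementBreaking {ι n : Type*} [Fintype ι] [Fintype n]
    [DecidableEq n] [Nonempty n] {E : Superoperator n} (hE : IsMeasurePrepare ι E)
    (htp : IsTracePreserving E) : IsEntanglementBreaking E := by
  refine ⟨hE.isChannel htp, fun k σ hσ => ?_⟩
  obtain ⟨m, ρ, hm, hρ, hE⟩ := hE
  -- A zero-dimensional ancilla carries no unit-trace operator; nonemptiness supplies a filler state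
  -- for outcomes of probability zero.
  have : Nonempty (Fin k) := by
    by_contra hk
    rw [not_nonempty_iff] at hk
    have h := hσ.2
    simp [Matrix.trace] at h
  choose p A hp hA hPA using fun l =>
    exists_eq_smul_isDensityMatrix (posSemidef_conditionalState (hm l) hσ.1)
  choose q B hq hB hPB using fun l => exists_eq_smul_isDensityMatrix (hρ l)
  have hsum : ampliation k E σ = ∑ l, ((p l * q l : ℝ) : ℂ) • (A l ⊗ₖ B l) := by
    rw [ampliation_eq_sum_conditionalState hE]
    refine Finset.sum_congr rfl fun l _ => ?_
    rw [hPA, hPB, Matrix.smul_kronecker, Matrix.kronecker_smul, smul_smul, Complex.ofReal_mul]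
  let e := (Fintype.equivFin ι).symm
  refine ⟨Fintype.card ι, fun i => p (e i) * q (e i), fun i => A (e i), fun i => B (e i),
    fun i => mul_nonneg (hp _) (hq _), ?_, fun i => hA _, fun i => hB _, ?_⟩
  · rw [e.sum_comp fun l => p l * q l]
    have h := trace_ampliation htp k σ
    rw [hσ.2, hsum, Matrix.trace_sum] at h
    simp only [Matrix.trace_smul, Matrix.trace_kronecker, (hA _).2, (hB _).2, smul_eq_mul,
      mul_one] at h
    exact_mod_cast h
  · rw [hsum]
    exact (e.sum_comp fun l => ((p l * q l : ℝ) : ℂ) • (A l ⊗ₖ B l)).symm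

/-- Weights, effect vectors and preparation vectors of measure-and-prepare channels. -/
def holevoParameters (ι : Type*) [Fintype ι] :
    Set ((ι → ℝ) × (ι → Fin 3 → ℝ) × (ι → Fin 3 → ℝ)) :=
  {q | (∀ k, 0 ≤ q.1 k) ∧ (∀ k, q.2.1 k ⬝ᵥ q.2.1 k ≤ 1) ∧ (∀ k, q.2.2 k ⬝ᵥ q.2.2 k ≤ 1) ∧
    ∑ k, q.1 k = 1 ∧ ∑ k, q.1 k • q.2.1 k = 0}

/-- The affine map of the Bloch ball with given measure-and-prepare parameters. -/
noncomputable def holevoMap (ι : Type*) [Fintype ι]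
    (q : (ι → ℝ) × (ι → Fin 3 → ℝ) × (ι → Fin 3 → ℝ)) :
    (Fin 3 → ℝ) × Matrix (Fin 3) (Fin 3) ℝ :=
  (∑ k, q.1 k • q.2.2 k, ∑ k, q.1 k • vecMulVec (q.2.2 k) (q.2.1 k))

theorem isCompact_holevoParameters (ι : Type*) [Fintype ι] : IsCompact (holevoParameters ι) := by
  have hc : IsCompact ((Set.Icc (0 : ι → ℝ) 1) ×ˢ
      ((Set.Icc (-1 : ι → Fin 3 → ℝ) 1) ×ˢ (Set.Icc (-1 : ι → Fin 3 → ℝ) 1))) :=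
    isCompact_Icc.prod (isCompact_Icc.prod isCompact_Icc)
  have hb {x : Fin 3 → ℝ} (hx : x ⬝ᵥ x ≤ 1) (i : Fin 3) : -1 ≤ x i ∧ x i ≤ 1 := by
    refine abs_le.mp (abs_le_one_iff_mul_self_le_one.mpr (le_trans ?_ hx))
    exact Finset.single_le_sum (f := fun i => x i * x i) (fun _ _ => mul_self_nonneg _)
      (Finset.mem_univ i)
  refine hc.of_isClosed_subset ?_ ?_
  · have e (k : ι) : Continuous fun q : (ι → ℝ) × (ι → Fin 3 → ℝ) × (ι → Fin 3 → ℝ) =>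
        q.2.1 k ⬝ᵥ q.2.1 k := Continuous.dotProduct (by fun_prop) (by fun_prop)
    have e' (k : ι) : Continuous fun q : (ι → ℝ) × (ι → Fin 3 → ℝ) × (ι → Fin 3 → ℝ) =>
        q.2.2 k ⬝ᵥ q.2.2 k := Continuous.dotProduct (by fun_prop) (by fun_prop)
    simp only [holevoParameters, Set.ofPred_and, Set.ofPred_forall]
    refine (isClosed_iInter fun k => isClosed_le continuous_const (by fun_prop)).inter
      ((isClosed_iInter fun k => isClosed_le (e k) continuous_const).inter
      ((isClosed_iInter fun k => isClosed_le (e' k) continuous_const).inter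
      ((isClosed_eq (by fun_prop) continuous_const).inter
      (isClosed_eq (by fun_prop) continuous_const))))
  · rintro ⟨α, μ, r⟩ ⟨h1, h2, h3, h4, -⟩
    refine ⟨⟨h1, fun k => ?_⟩, ⟨fun k i => (hb (h2 k) i).1, fun k i => (hb (h2 k) i).2⟩,
      ⟨fun k i => (hb (h3 k) i).1, fun k i => (hb (h3 k) i).2⟩⟩
    rw [Pi.one_apply, ← h4]
    exact Finset.single_le_sum (fun i _ => h1 i) (Finset.mem_univ k)

theorem isClosed_holevoMap_image (ι : Type*) [Fintype ι] :
    IsClosed (holevoMap ι '' holevoParameters ι) := by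
  refine ((isCompact_holevoParameters ι).image ?_).isClosed
  unfold holevoMap
  refine Continuous.prodMk (by fun_prop) (continuous_finsetSum _ fun k _ => ?_)
  have h1 : Continuous fun q : (ι → ℝ) × (ι → Fin 3 → ℝ) × (ι → Fin 3 → ℝ) => q.2.1 k := by
    fun_prop
  have h2 : Continuous fun q : (ι → ℝ) × (ι → Fin 3 → ℝ) × (ι → Fin 3 → ℝ) => q.2.2 k := by
    fun_prop
  have h0 : Continuous fun q : (ι → ℝ) × (ι → Fin 3 → ℝ) × (ι → Fin 3 → ℝ) => q.1 k := by
    fun_prop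
  exact h0.smul (h2.matrix_vecMulVec h1)

theorem pauliCoord_sum {ι : Type*} [Fintype ι] (f : ι → Matrix (Fin 2) (Fin 2) ℂ) (i : Fin 3) :
    pauliCoord (∑ k, f k) i = ∑ k, pauliCoord (f k) i := by
  fin_cases i <;> simp [pauliCoord, Matrix.sum_apply, ← Finset.mul_sum, Finset.sum_add_distrib,
    Finset.sum_sub_distrib]

theorem trace_hermPauli_mul (c : ℝ) (x : Fin 3 → ℝ) (X : Matrix (Fin 2) (Fin 2) ℂ) :
    (hermPauli c x * X).trace = (c * X.trace + ∑ j, x j * pauliCoord X j) / 2 := by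
  simp [hermPauli, ofPauli, Matrix.trace_fin_two, pauliCoord, Fin.sum_univ_three,
    Matrix.vecMul, dotProduct, Fin.sum_univ_two]
  ring

theorem exists_eq_hermPauli_smul {X : Matrix (Fin 2) (Fin 2) ℂ} (hX : X.PosSemidef) :
    ∃ (c : ℝ) (μ : Fin 3 → ℝ), 0 ≤ c ∧ μ ⬝ᵥ μ ≤ 1 ∧ X = hermPauli c (c • μ) := by
  obtain ⟨c, x, rfl⟩ := exists_eq_hermPauli hX.isHermitian
  obtain ⟨hc, hx⟩ := posSemidef_hermPauli.mp hX
  rcases hc.eq_or_lt with rfl | hc'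
  · have h0 : x ⬝ᵥ x = 0 := le_antisymm (by simpa using hx) (dotProduct_self_nonneg x)
    rw [dotProduct_self_eq_zero] at h0
    exact ⟨0, 0, le_rfl, by simp, by simp [h0]⟩
  · refine ⟨c, c⁻¹ • x, hc, ?_, ?_⟩
    · rw [dotProduct_smul, smul_dotProduct, smul_eq_mul, smul_eq_mul, ← mul_assoc, ← mul_inv,
        ← sq, inv_mul_le_one₀ (by positivity)]
      exact hx
    · rw [smul_smul, mul_inv_cancel₀ hc'.ne', one_smul]

/-- Normalizing effects and preparations turns the form into x ↦ ∑ α k (1 + μ k · x) r k. Trace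
preservation amounts to ∑ α k = 1 and ∑ α k μ k = 0, so the parameters range over a compact set. -/
theorem isMeasurePrepare_blochMap_iff {ι : Type*} [Fintype ι] {t : Fin 3 → ℝ}
    {D : Matrix (Fin 3) (Fin 3) ℝ} :
    IsMeasurePrepare ι (blochMap t D) ↔ (t, D) ∈ holevoMap ι '' holevoParameters ι := by
  constructor
  · rintro ⟨m, ρ, hm, hρ, h⟩
    choose c μ hc hμ hcμ using fun k => exists_eq_hermPauli_smul (hm k)
    choose d r hd hr hdr using fun k => exists_eq_hermPauli_smul (hρ k)
    have htr (a : ℂ) (y : Fin 3 → ℂ) :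
        ∑ k, ((c k * d k / 2 : ℝ) : ℂ) * (a + ∑ j, μ k j * y j) = a := by
      have h1 := congrArg Matrix.trace (h (ofPauli a y))
      rw [isTracePreserving_blochMap, trace_ofPauli, Matrix.trace_sum] at h1
      refine Eq.trans (Finset.sum_congr rfl fun k _ => ?_) h1.symm
      rw [Matrix.trace_smul, hcμ, hdr, trace_hermPauli_mul, trace_hermPauli, trace_ofPauli,
        pauliCoord_ofPauli]
      simp only [Fin.sum_univ_three, Pi.smul_apply, smul_eq_mul]
      push_cast
      ring
    have hco (a : ℂ) (y : Fin 3 → ℂ) (i : Fin 3) :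
        ∑ k, ((c k * d k / 2 : ℝ) : ℂ) * (a + ∑ j, μ k j * y j) * r k i
          = t i * a + ∑ j, D i j * y j := by
      have h1 := congrArg (fun X => pauliCoord X i) (h (ofPauli a y))
      simp only [pauliCoord_blochMap, trace_ofPauli, pauliCoord_ofPauli, pauliCoord_sum] at h1
      rw [h1]
      refine Finset.sum_congr rfl fun k _ => ?_
      rw [pauliCoord_smul, Pi.smul_apply, hcμ, hdr, trace_hermPauli_mul, pauliCoord_hermPauli,
        trace_ofPauli, pauliCoord_ofPauli]
      simp only [Fin.sum_univ_three, Pi.smul_apply, smul_eq_mul]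
      push_cast
      ring
    -- The weight is the product of the two traces, halved because tr(m X) is half the pairing of
    -- Pauli coordinates.
    refine ⟨(fun k => c k * d k / 2, μ, r),
      ⟨fun k => by have := mul_nonneg (hc k) (hd k); change 0 ≤ c k * d k / 2; linarith,
        hμ, hr, ?_, ?_⟩, ?_⟩
    · have := htr 1 0
      simp only [Pi.zero_apply, mul_zero, Finset.sum_const_zero, add_zero, mul_one] at this
      exact_mod_cast this
    · ext j
      have := htr 0 (Pi.single j 1)
      simp only [Pi.single_apply, mul_ite, mul_one, mul_zero, Finset.sum_ite_eq',
        Finset.mem_univ, if_true, zero_add] at this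
      rw [Finset.sum_apply]
      exact_mod_cast this
    · refine Prod.ext ?_ ?_
      · ext i
        have := hco 1 0 i
        simp only [Pi.zero_apply, mul_zero, Finset.sum_const_zero, add_zero, mul_one] at this
        simp only [holevoMap, Finset.sum_apply, Pi.smul_apply, smul_eq_mul]
        exact_mod_cast this
      · ext i j
        have := hco 0 (Pi.single j 1) i
        simp only [Pi.single_apply, mul_ite, mul_one, mul_zero, Finset.sum_ite_eq',
          Finset.mem_univ, if_true, zero_add] at this
        simp only [holevoMap, Matrix.sum_apply, Matrix.smul_apply, smul_eq_mul, vecMulVec_apply]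
        rw [← Complex.ofReal_inj, ← this]
        push_cast
        exact Finset.sum_congr rfl fun k _ => by ring
  · rintro ⟨⟨α, μ, r⟩, ⟨h1, h2, h3, h4, h5⟩, hq⟩
    simp only [holevoMap, Prod.mk.injEq] at hq h1 h2 h3 h4 h5
    obtain ⟨rfl, rfl⟩ := hq
    refine ⟨fun k => hermPauli (2 * α k) ((2 * α k) • μ k), fun k => hermPauli 1 (r k),
      fun k => posSemidef_hermPauli.mpr ⟨by linarith [h1 k], ?_⟩,
      fun k => posSemidef_hermPauli.mpr ⟨zero_le_one, by simpa using h3 k⟩, fun X => ?_⟩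
    · rw [dotProduct_smul, smul_dotProduct, smul_eq_mul, smul_eq_mul, ← mul_assoc, ← sq]
      exact mul_le_of_le_one_right (sq_nonneg _) (h2 k)
    · have hw (k : ι) : (hermPauli (2 * α k) ((2 * α k) • μ k) * X).trace
          = α k * (X.trace + ∑ j, μ k j * pauliCoord X j) := by
        rw [trace_hermPauli_mul]
        simp only [Fin.sum_univ_three, Pi.smul_apply, smul_eq_mul]
        push_cast
        ring
      have h5' (j : Fin 3) : ∑ k, (α k : ℂ) * μ k j = 0 := by
        have := congrFun h5 j
        rw [Finset.sum_apply] at this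
        exact_mod_cast this
      have h4' : ∑ k, (α k : ℂ) = 1 := by exact_mod_cast h4
      simp only [hw]
      refine ext_pauli ?_ ?_
      · rw [isTracePreserving_blochMap, Matrix.trace_sum]
        simp only [Matrix.trace_smul, trace_hermPauli, Complex.ofReal_one, smul_eq_mul, mul_one,
          mul_add, Finset.sum_add_distrib, ← Finset.sum_mul, h4', one_mul, Finset.mul_sum,
          ← mul_assoc]
        rw [Finset.sum_comm]
        simp only [← Finset.sum_mul, h5', zero_mul, Finset.sum_const_zero, add_zero]
      · ext i
        rw [pauliCoord_blochMap, pauliCoord_sum]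
        simp only [Fin.sum_univ_three, pauliCoord_smul, Pi.smul_apply, pauliCoord_hermPauli,
          Finset.sum_apply, smul_eq_mul, Matrix.sum_apply, Matrix.smul_apply, vecMulVec_apply]
        push_cast
        simp only [Finset.sum_mul, ← Finset.sum_add_distrib]
        exact Finset.sum_congr rfl fun k _ => by ring

/-- A unital map whose linear part has trace norm at most one is measure-and-prepare. -/
theorem isMeasurePrepare_blochMap_zero {W V : Matrix (Fin 3) (Fin 3) ℝ} (hW : Wᵀ * W = 1)
    (hV : Vᵀ * V = 1) {p : Fin 3 → ℝ} (hp : ∀ i, 0 ≤ p i) (hsum : ∑ i, p i ≤ 1) :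
    IsMeasurePrepare (Option (Fin 3 × Bool)) (blochMap 0 (W * diagonal p * Vᵀ)) := by
  rw [isMeasurePrepare_blochMap_iff]
  have hcol {U : Matrix (Fin 3) (Fin 3) ℝ} (hU : Uᵀ * U = 1) (i : Fin 3) :
      Uᵀ i ⬝ᵥ Uᵀ i ≤ 1 := by
    have := congrFun (congrFun hU i) i
    rw [Matrix.mul_apply, Matrix.one_apply_eq] at this
    exact this.le
  -- Outcome (i, ±) has weight p i / 2, effect ± the i-th column of V and preparation ± that of W:
  -- first moments cancel while the rank-one terms add. The leftover weight goes to an uninformative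
  -- outcome preparing the centre.
  refine ⟨(fun o => o.elim (1 - ∑ i, p i) fun k => p k.1 / 2,
    fun o => o.elim 0 fun k => bif k.2 then Vᵀ k.1 else -Vᵀ k.1,
    fun o => o.elim 0 fun k => bif k.2 then Wᵀ k.1 else -Wᵀ k.1), ⟨?_, ?_, ?_, ?_, ?_⟩, ?_⟩
  · rintro (_ | ⟨i, b⟩)
    · simpa using hsum
    · have := hp i
      simp only [Option.elim_some]
      linarith
  · rintro (_ | ⟨i, b | b⟩)
    · simp
    · simpa using hcol hV i
    · simpa using hcol hV i
  · rintro (_ | ⟨i, b | b⟩)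
    · simp
    · simpa using hcol hW i
    · simpa using hcol hW i
  · simp only [Fintype.sum_option, Fintype.sum_prod_type, Fintype.sum_bool, Option.elim_none,
      Option.elim_some, add_halves]
    ring
  · simp [Fintype.sum_option, Fintype.sum_prod_type]
  · refine Prod.ext ?_ ?_
    · simp [holevoMap, Fintype.sum_option, Fintype.sum_prod_type]
    · ext i j
      change _ = (W * diagonal p * Vᵀ) i j
      rw [Matrix.mul_apply]
      simp only [holevoMap, Fintype.sum_option, Fintype.sum_prod_type, Fintype.sum_bool,
        Option.elim_none, Option.elim_some, Matrix.sum_apply, Matrix.add_apply,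
        Matrix.smul_apply, vecMulVec_apply, cond_true, cond_false, Pi.neg_apply, transpose_apply,
        smul_eq_mul, Pi.zero_apply, mul_zero, zero_add, Matrix.mul_diagonal]
      exact Finset.sum_congr rfl fun k _ => by ring

/-! ### Mixtures of channels and nonnegative determinant -/

theorem IsChannel.isPTP {n : Type*} [Fintype n] {E : Superoperator n} (hE : IsChannel E) :
    IsPTP E := by
  refine ⟨fun X hX => ?_, hE.2⟩
  have h := hE.1 1 (X.submatrix Prod.snd Prod.snd) (hX.submatrix _)
  exact h.submatrix fun i => ((0 : Fin 1), i)

theorem ampliation_combo {n : Type*} (k : ℕ) (a b : ℂ) (E F : Superoperator n)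
    (X : Matrix (Fin k × n) (Fin k × n) ℂ) :
    ampliation k (a • E + b • F) X = a • ampliation k E X + b • ampliation k F X := rfl

theorem IsChannel.combo {n : Type*} [Fintype n] {E F : Superoperator n} (hE : IsChannel E)
    (hF : IsChannel F) {a b : ℝ} (ha : 0 ≤ a) (hb : 0 ≤ b) (hab : a + b = 1) :
    IsChannel ((a : ℂ) • E + (b : ℂ) • F) := by
  refine ⟨fun k X hX => ?_, fun X => ?_⟩
  · rw [ampliation_combo]
    exact ((hE.1 k X hX).smul (by exact_mod_cast ha)).add
      ((hF.1 k X hX).smul (by exact_mod_cast hb))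
  · have hab' : (a : ℂ) + b = 1 := by exact_mod_cast hab
    rw [LinearMap.add_apply, LinearMap.smul_apply, LinearMap.smul_apply, Matrix.trace_add,
      Matrix.trace_smul, Matrix.trace_smul, hE.2, hF.2, ← add_smul, hab', one_smul]

/-- A singular matrix is a limit of matrices of positive determinant, along multiples of
orthogonal matrices. -/
theorem exists_orthogonal_det_add_smul_pos {D : Matrix (Fin 3) (Fin 3) ℝ} (hD : D.det = 0) {δ : ℝ}
    (hδ : 0 < δ) : ∃ x Q, 0 < x ∧ x < δ ∧ Qᵀ * Q = 1 ∧ 0 < (D + x • Q).det := by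
  -- Only the finitely many eigenvalues of -D make D + x singular.
  obtain ⟨x, hx, hx'⟩ := (Set.Ioo_infinite hδ).exists_notMem_finset (-D).charpoly.roots.toFinset
  have hne : (D + x • (1 : Matrix (Fin 3) (Fin 3) ℝ)).det ≠ 0 := by
    intro h
    refine hx' (Multiset.mem_toFinset.mpr ?_)
    rw [Polynomial.mem_roots (Matrix.charpoly_monic _).ne_zero, Polynomial.IsRoot,
      Matrix.eval_charpoly, sub_neg_eq_add, add_comm, ← h, Matrix.smul_one_eq_diagonal,
      Matrix.scalar_apply]
  rcases hne.lt_or_gt with h | h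
  · obtain ⟨v, hv, hDv⟩ := Matrix.exists_mulVec_eq_zero_iff.mpr hD
    have hvv : v ⬝ᵥ v ≠ 0 := by rwa [Ne, dotProduct_self_eq_zero]
    have hvec : vecMulVec v v * vecMulVec v v = (v ⬝ᵥ v) • vecMulVec v v := by
      rw [vecMulVec_mul_vecMulVec]
      ext i j
      simp [vecMulVec_apply]
      ring
    -- Reflection along a kernel vector v. It satisfies D Q = D, so D + x Q = (D + x) Q and the
    -- determinant changes sign.
    let Q : Matrix (Fin 3) (Fin 3) ℝ := 1 - (2 / (v ⬝ᵥ v)) • vecMulVec v v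
    have hDQ : D * Q = D := by
      rw [Matrix.mul_sub, Matrix.mul_one, Matrix.mul_smul, mul_vecMulVec, hDv]
      simp
    have hdet : Q.det = -1 := by
      have h1 (c : ℝ) : (1 - c • vecMulVec v v).det = 1 - c * (v ⬝ᵥ v) := by
        simp [Matrix.det_fin_three, vecMulVec_apply, dotProduct, Fin.sum_univ_three]
        ring
      rw [h1, div_mul_cancel₀ _ hvv]
      norm_num
    have hQt : Qᵀ = Q := by simp [Q, transpose_vecMulVec]
    refine ⟨x, Q, hx.1, hx.2, ?_, ?_⟩
    · rw [hQt]
      simp only [Q]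
      rw [Matrix.mul_sub, Matrix.mul_one, Matrix.sub_mul, Matrix.one_mul, Matrix.smul_mul,
        Matrix.mul_smul, hvec, smul_smul, smul_smul, mul_assoc,
        div_mul_cancel₀ _ hvv]
      module
    · have : D + x • Q = (D + x • (1 : Matrix (Fin 3) (Fin 3) ℝ)) * Q := by
        rw [Matrix.add_mul, hDQ, Matrix.smul_mul, Matrix.one_mul]
      rw [this, Matrix.det_mul, hdet]
      linarith
  · exact ⟨x, 1, hx.1, hx.2, by simp, h⟩

/-- The three singular values 1/3 sum to 1, so the map is measure-and-prepare even when Q reverses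
orientation. -/
theorem isChannel_blochMap_third_smul {Q : Matrix (Fin 3) (Fin 3) ℝ} (hQ : Qᵀ * Q = 1) :
    IsChannel (blochMap 0 ((1 / 3 : ℝ) • Q)) := by
  have h := isMeasurePrepare_blochMap_zero hQ (V := 1) (by simp) (p := fun _ => 1 / 3)
    (fun _ => by norm_num) (by norm_num [Fin.sum_univ_three])
  have e : Q * diagonal (fun _ => (1 / 3 : ℝ)) * 1ᵀ = (1 / 3 : ℝ) • Q := by
    rw [Matrix.transpose_one, Matrix.mul_one, ← Matrix.smul_one_eq_diagonal, Matrix.mul_smul,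
      Matrix.mul_one]
  rw [e] at h
  exact h.isChannel (isTracePreserving_blochMap _ _)

/-- A bound uniform in Q is needed because Q is chosen only after the size of the perturbation is
fixed. Orthogonal matrices lie in a compact cube. -/
theorem exists_superNorm_blochMap_third_smul_sub_lt (E : Superoperator (Fin 2)) :
    ∃ C : ℝ, 0 < C ∧ ∀ Q : Matrix (Fin 3) (Fin 3) ℝ, Qᵀ * Q = 1 →
      superNorm (blochMap 0 ((1 / 3 : ℝ) • Q) - E) < C := by
  have hc : Continuous fun Q : Fin 3 → Fin 3 → ℝ =>
      superNorm (blochMap 0 ((1 / 3 : ℝ) • Matrix.of Q) - E) := by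
    refine continuous_superNorm_blochMap_sub (t := fun _ => 0) continuous_const
      (continuous_matrix fun i j => ?_) E
    simp only [Matrix.smul_apply, of_apply]
    fun_prop
  obtain ⟨C, hC⟩ := (isCompact_Icc (a := (-1 : Fin 3 → Fin 3 → ℝ))
    (b := 1)).exists_bound_of_continuousOn hc.continuousOn
  refine ⟨|C| + 1, by positivity, fun Q hQ => ?_⟩
  have hb (i j : Fin 3) : -1 ≤ Q i j ∧ Q i j ≤ 1 := by
    refine abs_le.mp (abs_le_one_iff_mul_self_le_one.mpr ?_)
    have := congrFun (congrFun hQ j) j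
    rw [Matrix.mul_apply, Matrix.one_apply_eq] at this
    rw [← this]
    exact Finset.single_le_sum (f := fun i => Qᵀ j i * Q i j) (fun _ _ => mul_self_nonneg _)
      (Finset.mem_univ i)
  have := hC Q ⟨fun i j => (hb i j).1, fun i j => (hb i j).2⟩
  exact ((le_abs_self _).trans (this.trans (le_abs_self C))).trans_lt (lt_add_one _)

theorem mem_pInfinitesimalDivisible_of_det_nonneg {t : Fin 3 → ℝ} {D : Matrix (Fin 3) (Fin 3) ℝ}
    (hE : IsChannel (blochMap t D)) (hD : 0 ≤ D.det) :
    blochMap t D ∈ pInfinitesimalDivisible (Fin 2) := by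
  refine ⟨hE, fun ε hε => ?_⟩
  rcases hD.eq_or_lt with hD | hD
  · obtain ⟨C, hC, hC'⟩ := exists_superNorm_blochMap_third_smul_sub_lt (blochMap t D)
    obtain ⟨x, Q, hx, hxδ, hQ, hpos⟩ :=
      exists_orthogonal_det_add_smul_pos hD.symm (show 0 < ε / (3 * C) by positivity)
    have h3x : 0 < 1 + 3 * x := by linarith
    have hab : 1 / (1 + 3 * x) + 3 * x / (1 + 3 * x) = 1 := by field_simp
    -- These weights make the linear part (D + x Q) / (1 + 3x); the displacement is then at most 3 x
    -- C < ε.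
    have hF := hE.combo (isChannel_blochMap_third_smul hQ) (a := 1 / (1 + 3 * x))
      (b := 3 * x / (1 + 3 * x)) (by positivity) (by positivity) hab
    refine ⟨_, ⟨hF, ?_⟩, ?_⟩
    · have hF' := hF.isPTP
      rw [blochMap_combo _ _ hab] at hF' ⊢
      refine isPTPDivisible_of_det_pos hF' ?_
      have : (1 / (1 + 3 * x)) • D + (3 * x / (1 + 3 * x)) • (1 / 3 : ℝ) • Q
          = (1 / (1 + 3 * x)) • (D + x • Q) := by
        rw [smul_add, smul_smul, smul_smul]
        congr 2
        field_simp
      rw [this, Matrix.det_smul]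
      positivity
    · have hab' : ((1 / (1 + 3 * x) : ℝ) : ℂ) = 1 - ((3 * x / (1 + 3 * x) : ℝ) : ℂ) := by
        rw [eq_sub_iff_add_eq]
        exact_mod_cast hab
      have : ((1 / (1 + 3 * x) : ℝ) : ℂ) • blochMap t D +
          ((3 * x / (1 + 3 * x) : ℝ) : ℂ) • blochMap 0 ((1 / 3 : ℝ) • Q) - blochMap t D =
          ((3 * x / (1 + 3 * x) : ℝ) : ℂ) • (blochMap 0 ((1 / 3 : ℝ) • Q) - blochMap t D) := by
        rw [hab']; module
      rw [this, superNorm_smul, Complex.norm_real, Real.norm_of_nonneg (by positivity)]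
      calc 3 * x / (1 + 3 * x) * superNorm (blochMap 0 ((1 / 3 : ℝ) • Q) - blochMap t D)
          ≤ 3 * x * C := by
            refine mul_le_mul (div_le_self (by positivity) (by linarith)) (hC' Q hQ).le
              (Real.sqrt_nonneg _) (by positivity)
        _ < ε := by
            rw [lt_div_iff₀ (by positivity)] at hxδ
            linarith
  · exact ⟨_, ⟨hE, isPTPDivisible_of_det_pos hE.isPTP hD⟩, by rwa [sub_self, superNorm_zero]⟩

/-! ### Conjugations, the complete positivity test and singular values -/

/-- The conjugation `X ↦ a X a†`. -/
noncomputable def conjBy (a : Matrix (Fin 2) (Fin 2) ℂ) : Superoperator (Fin 2) :=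
  LinearMap.mulLeft ℂ a * LinearMap.mulRight ℂ aᴴ

theorem conjBy_apply (a X : Matrix (Fin 2) (Fin 2) ℂ) : conjBy a X = a * X * aᴴ := by
  rw [conjBy, Module.End.mul_apply, LinearMap.mulLeft_apply, LinearMap.mulRight_apply,
    Matrix.mul_assoc]

theorem conjBy_mul (a b : Matrix (Fin 2) (Fin 2) ℂ) : conjBy a * conjBy b = conjBy (a * b) := by
  ext1 X
  simp only [Module.End.mul_apply, conjBy_apply, conjTranspose_mul, Matrix.mul_assoc]

theorem conjBy_one : conjBy 1 = 1 := by
  ext1 X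
  simp [conjBy_apply]

theorem conjBy_posSemidef (a : Matrix (Fin 2) (Fin 2) ℂ) {X : Matrix (Fin 2) (Fin 2) ℂ}
    (hX : X.PosSemidef) : (conjBy a X).PosSemidef := by
  rw [conjBy_apply]
  exact hX.mul_mul_conjTranspose_same a

/-- In matrix units the map is a ⊗ ā. For invertible a the determinant is positive, so filtering
preserves the sign of det E. -/
theorem det_conjBy (a : Matrix (Fin 2) (Fin 2) ℂ) :
    LinearMap.det (conjBy a) = ((Complex.normSq a.det ^ 2 : ℝ) : ℂ) := by
  rw [← LinearMap.det_toMatrix (Matrix.stdBasis ℂ (Fin 2) (Fin 2))]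
  have : LinearMap.toMatrix (Matrix.stdBasis ℂ (Fin 2) (Fin 2))
      (Matrix.stdBasis ℂ (Fin 2) (Fin 2)) (conjBy a) = a ⊗ₖ (aᴴ)ᵀ := by
    ext p q
    rw [LinearMap.toMatrix_apply, Matrix.stdBasis_eq_single, conjBy_apply]
    change (a * Matrix.single q.1 q.2 (1 : ℂ) * aᴴ) p.1 p.2 = a p.1 q.1 * aᴴ q.2 p.2
    simp [Matrix.mul_apply, Matrix.single_apply, Fin.sum_univ_two]
    obtain ⟨q1, q2⟩ := q
    fin_cases q1 <;> fin_cases q2 <;> simp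
  rw [this, Matrix.det_kronecker, Matrix.det_transpose, Matrix.det_conjTranspose]
  simp only [Fintype.card_fin, Complex.star_def]
  rw [← mul_pow, Complex.mul_conj]
  push_cast
  rfl

/-- Complete positivity tested on conjugated maximally entangled vectors. -/
theorem IsChannel.trace_conjBy_mul_nonneg {E : Superoperator (Fin 2)} (hE : IsChannel E)
    (K : Matrix (Fin 2) (Fin 2) ℂ) : 0 ≤ LinearMap.trace ℂ _ (conjBy K * E) := by
  let ω : Fin 2 × Fin 2 → ℂ := fun p => if p.1 = p.2 then 1 else 0
  have hC := hE.1 2 _ (Matrix.posSemidef_vecMulVec_self_star ω)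
  -- The quadratic form of the Choi matrix at the entrywise conjugate of K is the trace of `conjBy K
  -- * E`.
  have h := hC.dotProduct_mulVec_nonneg fun p => star (K p.1 p.2)
  have hentry (i j k l : Fin 2) : ampliation 2 E (vecMulVec ω (star ω)) (i, k) (j, l)
      = E (Matrix.single i j 1) k l := by
    have : (Matrix.of fun a b => vecMulVec ω (star ω) (i, a) (j, b)) = Matrix.single i j 1 := by
      ext a b
      fin_cases i <;> fin_cases j <;> fin_cases a <;> fin_cases b <;>
        simp [ω, vecMulVec_apply]
    rw [← this]
    rfl
  convert h using 1
  rw [LinearMap.trace_eq_matrix_trace ℂ (Matrix.stdBasis ℂ (Fin 2) (Fin 2))]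
  simp only [Matrix.trace, diag_apply, LinearMap.toMatrix_apply, Fintype.sum_prod_type,
    dotProduct, mulVec, hentry, Matrix.stdBasis_eq_single, Pi.star_apply, star_star]
  have e (X : Matrix (Fin 2) (Fin 2) ℂ) (i j : Fin 2) :
      (Matrix.stdBasis ℂ (Fin 2) (Fin 2)).repr X (i, j) = X i j := rfl
  simp only [e, Module.End.mul_apply, conjBy_apply, Matrix.mul_apply, Fin.sum_univ_two,
    conjTranspose_apply]
  ring

/-- Every rotation of the Bloch ball is implemented by a conjugation. -/
theorem exists_conjBy_eq_blochMap {R : Matrix (Fin 3) (Fin 3) ℝ} (hR : Rᵀ * R = 1)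
    (hdet : R.det = 1) : ∃ U, conjBy U = blochMap 0 R := by
  have hz (θ : ℝ) : ∃ U, conjBy U = blochMap 0 (rotZ θ) := by
    obtain ⟨h, rfl⟩ : ∃ h, θ = 2 * h := ⟨θ / 2, by ring⟩
    -- Half angles appear because SU(2) covers the rotation group twice.
    refine ⟨!![Real.cos h - Complex.I * Real.sin h, 0;
      0, Real.cos h + Complex.I * Real.sin h], ?_⟩
    have hcs : (Real.cos h : ℂ) ^ 2 + (Real.sin h : ℂ) ^ 2 = 1 := by
      exact_mod_cast Real.cos_sq_add_sin_sq h
    have hc2 : (Real.cos (2 * h) : ℂ) = (Real.cos h : ℂ) ^ 2 - (Real.sin h : ℂ) ^ 2 := by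
      rw [Real.cos_two_mul']; push_cast; ring
    have hs2 : (Real.sin (2 * h) : ℂ) = 2 * (Real.sin h : ℂ) * (Real.cos h : ℂ) := by
      rw [Real.sin_two_mul]; push_cast; ring
    have hI := Complex.I_sq
    ext1 X
    rw [conjBy_apply, blochMap_apply]
    ext i j
    fin_cases i <;> fin_cases j <;> simp [ofPauli, pauliCoord, rotZ, Fin.sum_univ_three,
      Matrix.trace_fin_two, Matrix.mul_apply, Matrix.vecMul, dotProduct, -Complex.ofReal_cos,
      -Complex.ofReal_sin, hc2, hs2] <;> clear hc2 hs2 <;> grind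
  have hx (θ : ℝ) : ∃ U, conjBy U = blochMap 0 (rotX θ) := by
    obtain ⟨h, rfl⟩ : ∃ h, θ = 2 * h := ⟨θ / 2, by ring⟩
    refine ⟨!![(Real.cos h : ℂ), -Complex.I * Real.sin h;
      -Complex.I * Real.sin h, Real.cos h], ?_⟩
    have hcs : (Real.cos h : ℂ) ^ 2 + (Real.sin h : ℂ) ^ 2 = 1 := by
      exact_mod_cast Real.cos_sq_add_sin_sq h
    have hc2 : (Real.cos (2 * h) : ℂ) = (Real.cos h : ℂ) ^ 2 - (Real.sin h : ℂ) ^ 2 := by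
      rw [Real.cos_two_mul']; push_cast; ring
    have hs2 : (Real.sin (2 * h) : ℂ) = 2 * (Real.sin h : ℂ) * (Real.cos h : ℂ) := by
      rw [Real.sin_two_mul]; push_cast; ring
    have hI := Complex.I_sq
    ext1 X
    rw [conjBy_apply, blochMap_apply]
    ext i j
    fin_cases i <;> fin_cases j <;> simp [ofPauli, pauliCoord, rotX, Fin.sum_univ_three,
      Matrix.trace_fin_two, Matrix.mul_apply, Matrix.vecMul, dotProduct, -Complex.ofReal_cos,
      -Complex.ofReal_sin, hc2, hs2] <;> clear hc2 hs2 <;> grind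
  obtain ⟨a, b, c, rfl⟩ := exists_eq_rotZ_mul_rotX_mul_rotZ hR hdet
  obtain ⟨u, hu⟩ := hz a
  obtain ⟨v, hv⟩ := hx b
  obtain ⟨w, hw⟩ := hz c
  refine ⟨u * v * w, ?_⟩
  rw [← conjBy_mul, ← conjBy_mul, hu, hv, hw, blochMap_mul, blochMap_mul]
  simp

theorem posSemidef_exists_eq_mul_conjTranspose {A : Matrix (Fin 2) (Fin 2) ℂ}
    (hA : A.PosSemidef) : ∃ a, A = a * aᴴ := by
  open scoped MatrixOrder in
  obtain ⟨b, hb⟩ := CStarAlgebra.nonneg_iff_eq_star_mul_self.mp (Matrix.nonneg_iff_posSemidef.mpr hA)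
  exact ⟨bᴴ, by rw [conjTranspose_conjTranspose]; exact hb⟩

/-- Singular value decomposition of an orientation reversing matrix, with the polar rotation
written as a proper one. -/
theorem exists_singularValueDecomposition {D : Matrix (Fin 3) (Fin 3) ℝ} (hD : D.det < 0) :
    ∃ (W V : Matrix (Fin 3) (Fin 3) ℝ) (p : Fin 3 → ℝ), Wᵀ * W = 1 ∧ Vᵀ * V = 1 ∧
      (∀ i, 0 ≤ p i) ∧ D = W * diagonal p * Vᵀ ∧ (-(V * Wᵀ)).det = 1 := by
  have hinj : Function.Injective D.mulVec :=
    Matrix.mulVec_injective_of_isUnit ((Matrix.isUnit_iff_isUnit_det D).mpr hD.ne.isUnit)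
  have hS : (Dᵀ * D).PosDef := by
    have := Matrix.PosDef.conjTranspose_mul_self D hinj
    rwa [Matrix.conjTranspose_eq_transpose_of_trivial] at this
  have hH := hS.isHermitian
  let V : Matrix (Fin 3) (Fin 3) ℝ := (hH.eigenvectorUnitary : Matrix (Fin 3) (Fin 3) ℝ)
  have hV : Vᵀ * V = 1 := by
    have := Unitary.coe_star_mul_self hH.eigenvectorUnitary
    rwa [Matrix.star_eq_conjTranspose, Matrix.conjTranspose_eq_transpose_of_trivial] at this
  have hV' : V * Vᵀ = 1 := mul_eq_one_comm.mp hV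
  have hdiag : Vᵀ * (Dᵀ * D) * V = diagonal hH.eigenvalues := by
    have h := hH.conjStarAlgAut_star_eigenvectorUnitary
    rw [Unitary.conjStarAlgAut_star_apply, Matrix.star_eq_conjTranspose,
      Matrix.conjTranspose_eq_transpose_of_trivial] at h
    exact h
  have heig (i : Fin 3) : 0 < hH.eigenvalues i := hS.eigenvalues_pos i
  let p : Fin 3 → ℝ := fun i => √(hH.eigenvalues i)
  have hp (i : Fin 3) : 0 < p i := Real.sqrt_pos.mpr (heig i)
  let W : Matrix (Fin 3) (Fin 3) ℝ := D * V * diagonal fun i => (p i)⁻¹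
  have hW : Wᵀ * W = 1 := by
    have e : Wᵀ * W = diagonal (fun i => (p i)⁻¹) * (Vᵀ * (Dᵀ * D) * V)
        * diagonal (fun i => (p i)⁻¹) := by
      simp only [W, Matrix.transpose_mul, Matrix.diagonal_transpose, Matrix.mul_assoc]
    rw [e, hdiag, Matrix.diagonal_mul_diagonal, Matrix.diagonal_mul_diagonal, ← diagonal_one]
    congr 1
    ext i
    have h1 : p i * p i = hH.eigenvalues i := Real.mul_self_sqrt (heig i).le
    rw [← h1]
    have := (hp i).ne'
    field_simp
  have hDW : D = W * diagonal p * Vᵀ := by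
    simp only [W]
    rw [Matrix.mul_assoc (D * V), Matrix.diagonal_mul_diagonal]
    have : (fun i => (p i)⁻¹ * p i) = fun _ => (1 : ℝ) := by
      ext i; exact inv_mul_cancel₀ (hp i).ne'
    rw [this, diagonal_one, Matrix.mul_one, Matrix.mul_assoc, hV', Matrix.mul_one]
  refine ⟨W, V, p, hW, hV, fun i => (hp i).le, hDW, ?_⟩
  have hdW := congrArg Matrix.det hW
  have hdV := congrArg Matrix.det hV
  rw [Matrix.det_mul, Matrix.det_transpose, Matrix.det_one] at hdW hdV
  have hprod : 0 < ∏ i, p i := Finset.prod_pos fun i _ => hp i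
  have hneg : W.det * V.det < 0 := by
    rw [hDW, Matrix.det_mul, Matrix.det_mul, Matrix.det_diagonal, Matrix.det_transpose] at hD
    by_contra! h
    have := mul_nonneg h hprod.le
    linarith
  -- In odd dimension negation flips the determinant, so det W · det V = -1 becomes +1.
  rw [Matrix.det_neg, Matrix.det_mul, Matrix.det_transpose, Fintype.card_fin]
  have hsq : (W.det * V.det) * (W.det * V.det) = 1 := by
    calc _ = (W.det * W.det) * (V.det * V.det) := by ring
      _ = 1 := by rw [hdW, hdV, one_mul]
  have : W.det * V.det = -1 := by nlinarith
  linarith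

/-! ### Scaling to unital form and negative determinant -/

/-- Maximizing the ratio of determinants `det X / det E(X)` over states. -/
theorem exists_scaling_point {t : Fin 3 → ℝ} {D : Matrix (Fin 3) (Fin 3) ℝ}
    (h : ∀ x : Fin 3 → ℝ, x ⬝ᵥ x ≤ 1 → (t + D *ᵥ x) ⬝ᵥ (t + D *ᵥ x) < 1) :
    ∃ (x : Fin 3 → ℝ) (c : ℝ), x ⬝ᵥ x < 1 ∧ 0 < c ∧
      1 - x ⬝ᵥ x = c * (1 - (t + D *ᵥ x) ⬝ᵥ (t + D *ᵥ x)) ∧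
      ∀ v, c * ((t + D *ᵥ x) ⬝ᵥ (D *ᵥ v)) = x ⬝ᵥ v := by
  have hcy : Continuous fun x : Fin 3 → ℝ => t + D *ᵥ x :=
    continuous_const.add (Continuous.matrix_mulVec continuous_const continuous_id)
  have hcd : Continuous fun x : Fin 3 → ℝ => x ⬝ᵥ x := continuous_id.dotProduct continuous_id
  let K : Set (Fin 3 → ℝ) := {x | x ⬝ᵥ x ≤ 1}
  have hK : IsCompact K := by
    refine (isCompact_Icc (a := (-1 : Fin 3 → ℝ)) (b := 1)).of_isClosed_subset
      (isClosed_le hcd continuous_const) fun x hx => ?_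
    have hb (i : Fin 3) : -1 ≤ x i ∧ x i ≤ 1 := by
      refine abs_le.mp (abs_le_one_iff_mul_self_le_one.mpr (le_trans ?_ hx))
      exact Finset.single_le_sum (f := fun i => x i * x i) (fun _ _ => mul_self_nonneg _)
        (Finset.mem_univ i)
    exact ⟨fun i => (hb i).1, fun i => (hb i).2⟩
  have hpos (x : Fin 3 → ℝ) (hx : x ∈ K) : 0 < 1 - (t + D *ᵥ x) ⬝ᵥ (t + D *ᵥ x) :=
    sub_pos.mpr (h x hx)
  have h0 : (0 : Fin 3 → ℝ) ∈ K := by simp [K]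
  obtain ⟨x, hxK, hmax⟩ := hK.exists_isMaxOn ⟨0, h0⟩
    (f := fun x => (1 - x ⬝ᵥ x) / (1 - (t + D *ᵥ x) ⬝ᵥ (t + D *ᵥ x)))
    (ContinuousOn.div (by fun_prop) (continuous_const.sub (hcy.dotProduct hcy)).continuousOn
      fun x hx => (hpos x hx).ne')
  set c := (1 - x ⬝ᵥ x) / (1 - (t + D *ᵥ x) ⬝ᵥ (t + D *ᵥ x)) with hc
  have hcpos : 0 < c := by
    refine lt_of_lt_of_le ?_ (hmax h0)
    have := hpos 0 h0
    simp only [dotProduct_zero, sub_zero]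
    exact div_pos one_pos this
  have hceq : 1 - x ⬝ᵥ x = c * (1 - (t + D *ᵥ x) ⬝ᵥ (t + D *ᵥ x)) := by
    rw [hc, div_mul_cancel₀ _ (hpos x hxK).ne']
  -- The maximum is positive while the ratio vanishes on the sphere, so the maximizer is interior
  -- and all directions are admissible.
  have hx1 : x ⬝ᵥ x < 1 := by
    have := mul_pos hcpos (hpos x hxK)
    linarith
  refine ⟨x, c, hx1, hcpos, hceq, fun v => ?_⟩
  set y := t + D *ᵥ x with hy
  -- the nonnegative function `c (1 - |t + D z|²) - (1 - |z|²)` vanishes at `x`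
  let ℓ : ℝ := 2 * (x ⬝ᵥ v - c * (y ⬝ᵥ (D *ᵥ v)))
  let q : ℝ := v ⬝ᵥ v - c * ((D *ᵥ v) ⬝ᵥ (D *ᵥ v))
  have hexp (s : ℝ) : c * (1 - (t + D *ᵥ (x + s • v)) ⬝ᵥ (t + D *ᵥ (x + s • v)))
      - (1 - (x + s • v) ⬝ᵥ (x + s • v)) = s * ℓ + s ^ 2 * q := by
    have e : t + D *ᵥ (x + s • v) = y + s • (D *ᵥ v) := by
      rw [Matrix.mulVec_add, Matrix.mulVec_smul, hy, add_assoc]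
    rw [e]
    simp only [add_dotProduct, dotProduct_add, smul_dotProduct, dotProduct_smul, smul_eq_mul, ℓ, q,
      dotProduct_comm v x, dotProduct_comm (D *ᵥ v) y]
    linear_combination -hceq
  have hmin : IsLocalMin (fun s : ℝ => s * ℓ + s ^ 2 * q) 0 := by
    have hcont : Continuous fun s : ℝ => (x + s • v) ⬝ᵥ (x + s • v) :=
      Continuous.dotProduct (by fun_prop) (by fun_prop)
    have hev : ∀ᶠ s : ℝ in nhds 0, (x + s • v) ⬝ᵥ (x + s • v) < 1 :=
      hcont.continuousAt.eventually_lt continuousAt_const (by simpa using hx1)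
    filter_upwards [hev] with s hs
    have h1 := hmax (show x + s • v ∈ K from hs.le)
    have h2 : (1 - (x + s • v) ⬝ᵥ (x + s • v)) /
      (1 - (t + D *ᵥ (x + s • v)) ⬝ᵥ (t + D *ᵥ (x + s • v))) ≤ c := h1
    rw [div_le_iff₀ (hpos _ hs.le)] at h2
    rw [← hexp s]
    simpa using h2
  have hderiv : HasDerivAt (fun s : ℝ => s * ℓ + s ^ 2 * q) ℓ 0 := by
    exact ((hasDerivAt_mul_const (x := (0 : ℝ)) ℓ).add
      ((hasDerivAt_pow 2 (0 : ℝ)).mul_const q)).congr_deriv (by simp)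
  have := hmin.hasDerivAt_eq_zero hderiv
  simp only [ℓ] at this
  linarith

/-- The inner filter is absorbed into the effects by cyclicity of the trace, the outer one into the
preparations. -/
theorem IsMeasurePrepare.conjBy_mul_mul_conjBy {ι : Type*} [Fintype ι] {E : Superoperator (Fin 2)}
    (hE : IsMeasurePrepare ι E) (b a : Matrix (Fin 2) (Fin 2) ℂ) :
    IsMeasurePrepare ι (conjBy b * E * conjBy a) := by
  obtain ⟨m, ρ, hm, hρ, h⟩ := hE
  refine ⟨fun k => aᴴ * m k * a, fun k => conjBy b (ρ k),
    fun k => (hm k).conjTranspose_mul_mul_same a, fun k => conjBy_posSemidef b (hρ k), fun X => ?_⟩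
  rw [Module.End.mul_apply, Module.End.mul_apply, h, map_sum]
  refine Finset.sum_congr rfl fun k _ => ?_
  rw [map_smul, conjBy_apply a]
  congr 1
  beta_reduce
  rw [Matrix.mul_assoc aᴴ, Matrix.mul_assoc aᴴ, Matrix.trace_mul_comm aᴴ]
  simp only [Matrix.mul_assoc]

/-- A unital, trace preserving and completely positive map that reverses the orientation of the
Bloch ball is measure-and-prepare. -/
theorem isMeasurePrepare_of_unital {D : Matrix (Fin 3) (Fin 3) ℝ} (hD : D.det < 0)
    (hcp : ∀ R : Matrix (Fin 3) (Fin 3) ℝ, Rᵀ * R = 1 → R.det = 1 → 0 ≤ 1 + (R * D).trace) :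
    IsMeasurePrepare (Option (Fin 3 × Bool)) (blochMap 0 D) := by
  obtain ⟨W, V, p, hW, hV, hp, rfl, hdet⟩ := exists_singularValueDecomposition hD
  refine isMeasurePrepare_blochMap_zero hW hV hp ?_
  -- This rotation minimizes the trace: tr(R D) = -∑ p i.
  have h := hcp (-(V * Wᵀ)) ?_ hdet
  · have e : -(V * Wᵀ) * (W * diagonal p * Vᵀ) = -(V * diagonal p * Vᵀ) := by
      rw [Matrix.neg_mul, Matrix.mul_assoc V, ← Matrix.mul_assoc Wᵀ, ← Matrix.mul_assoc Wᵀ, hW,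
        Matrix.one_mul, ← Matrix.mul_assoc]
    rw [e, Matrix.trace_neg, Matrix.trace_mul_comm, ← Matrix.mul_assoc, hV, Matrix.one_mul,
      Matrix.trace_diagonal] at h
    linarith
  · rw [Matrix.transpose_neg, neg_mul_neg, Matrix.transpose_mul, Matrix.transpose_transpose,
      Matrix.mul_assoc, ← Matrix.mul_assoc Vᵀ, hV, Matrix.one_mul, mul_eq_one_comm.mp hW]

theorem hermPauli_mul_hermPauli_neg (x : Fin 3 → ℝ) :
    hermPauli 1 x * hermPauli 1 (-x) = (((1 - x ⬝ᵥ x) / 4 : ℝ) : ℂ) • (1 : Matrix _ _ ℂ) := by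
  have h : hermPauli 1 (-x) = (1 : Matrix _ _ ℂ) - hermPauli 1 x := by
    ext i j
    fin_cases i <;> fin_cases j <;> simp [hermPauli, ofPauli] <;> ring
  rw [h, Matrix.mul_sub, Matrix.mul_one, hermPauli_mul_self]
  simp

/-- The left side is the inverse of a a†, and inverting a qubit state reverses its Bloch vector up
to scale. -/
theorem inv_conjTranspose_mul_inv_eq {x : Fin 3 → ℝ} (hx : x ⬝ᵥ x < 1)
    {a : Matrix (Fin 2) (Fin 2) ℂ} (ha : hermPauli 1 x = a * aᴴ) :
    IsUnit a.det ∧ (a⁻¹)ᴴ * a⁻¹ = ((4 / (1 - x ⬝ᵥ x) : ℝ) : ℂ) • hermPauli 1 (-x) := by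
  have hpos : 0 < 1 - x ⬝ᵥ x := by linarith
  have hdet : IsUnit a.det := by
    have h := det_hermPauli 1 x
    rw [ha, Matrix.det_mul] at h
    refine (left_ne_zero_of_mul (b := aᴴ.det) ?_).isUnit
    rw [h, Ne, Complex.ofReal_eq_zero]
    have : 0 < ((1 : ℝ) ^ 2 - x ⬝ᵥ x) / 4 := by rw [one_pow]; positivity
    exact this.ne'
  refine ⟨hdet, ?_⟩
  have h1 : (hermPauli 1 x)⁻¹ = (a⁻¹)ᴴ * a⁻¹ := by
    rw [ha, Matrix.mul_inv_rev, Matrix.conjTranspose_nonsing_inv]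
  rw [← h1]
  refine Matrix.inv_eq_right_inv ?_
  rw [Matrix.mul_smul, hermPauli_mul_hermPauli_neg, smul_smul, ← Complex.ofReal_mul,
    div_mul_div_cancel₀ hpos.ne', div_self (by norm_num), Complex.ofReal_one, one_smul]

theorem hermPauli_two_zero : hermPauli 2 0 = 1 := by
  ext i j
  fin_cases i <;> fin_cases j <;> simp [hermPauli, ofPauli]

/-- Filters a and b with a a† and b b† the stationary state and its image reduce to the unital case;
being invertible, they can be undone afterwards. -/
theorem isMeasurePrepare_of_contractive {t : Fin 3 → ℝ} {D : Matrix (Fin 3) (Fin 3) ℝ}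
    (hE : IsChannel (blochMap t D)) (hD : D.det < 0)
    (h : ∀ x : Fin 3 → ℝ, x ⬝ᵥ x ≤ 1 → (t + D *ᵥ x) ⬝ᵥ (t + D *ᵥ x) < 1) :
    IsMeasurePrepare (Option (Fin 3 × Bool)) (blochMap t D) := by
  obtain ⟨x, c, hx, hc, hxy, hlin⟩ := exists_scaling_point h
  set y := t + D *ᵥ x with hydef
  have hy : y ⬝ᵥ y < 1 := h x hx.le
  obtain ⟨a, ha⟩ := posSemidef_exists_eq_mul_conjTranspose
    (posSemidef_hermPauli.mpr ⟨zero_le_one, by simpa using hx.le⟩ : (hermPauli 1 x).PosSemidef)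
  obtain ⟨b, hb⟩ := posSemidef_exists_eq_mul_conjTranspose
    (posSemidef_hermPauli.mpr ⟨zero_le_one, by simpa using hy.le⟩ : (hermPauli 1 y).PosSemidef)
  obtain ⟨hau, ha'⟩ := inv_conjTranspose_mul_inv_eq hx ha
  obtain ⟨hbu, hb'⟩ := inv_conjTranspose_mul_inv_eq hy hb
  set E' := conjBy b⁻¹ * blochMap t D * conjBy a with hE'
  have happly (X : Matrix (Fin 2) (Fin 2) ℂ) :
      E' X = b⁻¹ * blochMap t D (a * X * aᴴ) * (b⁻¹)ᴴ := by
    rw [hE', Module.End.mul_apply, Module.End.mul_apply, conjBy_apply, conjBy_apply]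
  have hunital : E' 1 = 1 := by
    rw [happly, Matrix.mul_one, ← ha, blochMap_hermPauli, one_smul, ← hydef, hb,
      ← Matrix.mul_assoc, Matrix.nonsing_inv_mul _ hbu, Matrix.one_mul, ← conjTranspose_mul,
      Matrix.nonsing_inv_mul _ hbu, conjTranspose_one]
  -- The adjoint map sends (b b†)⁻¹ to (a a†)⁻¹. This is the stationarity condition, and it makes
  -- the filtered map trace preserving.
  have hdual (Y : Matrix (Fin 2) (Fin 2) ℂ) :
      (((b⁻¹)ᴴ * b⁻¹) * blochMap t D Y).trace = (((a⁻¹)ᴴ * a⁻¹) * Y).trace := by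
    have hct : c * (1 - y ⬝ᵥ t) = 1 := by
      have h1 : y ⬝ᵥ y = y ⬝ᵥ t + y ⬝ᵥ (D *ᵥ x) := by rw [← dotProduct_add, ← hydef]
      linear_combination (-1 : ℝ) * hxy + hlin x + c * h1
    have hcD (j : Fin 3) : c * (y 0 * D 0 j + y 1 * D 1 j + y 2 * D 2 j) = x j := by
      have := hlin (Pi.single j 1)
      rw [dotProduct_single_one] at this
      simpa [dotProduct, Fin.sum_univ_three] using this
    have hct' : (c : ℂ) * (1 - (y 0 * t 0 + y 1 * t 1 + y 2 * t 2)) = 1 := by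
      rw [dotProduct, Fin.sum_univ_three] at hct
      exact_mod_cast hct
    have hcD' (j : Fin 3) : (c : ℂ) * (y 0 * D 0 j + y 1 * D 1 j + y 2 * D 2 j) = x j := by
      exact_mod_cast hcD j
    have hcne : (c : ℂ) ≠ 0 := by exact_mod_cast hc.ne'
    have hratio : ((4 / (1 - y ⬝ᵥ y) : ℝ) : ℂ) = c * ((4 / (1 - x ⬝ᵥ x) : ℝ) : ℂ) := by
      rw [← Complex.ofReal_mul, Complex.ofReal_inj, hxy]
      have : 1 - y ⬝ᵥ y ≠ 0 := by linarith
      field_simp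
    rw [ha', hb', hratio, Matrix.smul_mul, Matrix.smul_mul, Matrix.trace_smul, Matrix.trace_smul,
      trace_hermPauli_mul, trace_hermPauli_mul, isTracePreserving_blochMap]
    simp only [pauliCoord_blochMap, Fin.sum_univ_three, smul_eq_mul, Pi.neg_apply]
    push_cast
    linear_combination ((4 / (1 - ((x ⬝ᵥ x : ℝ) : ℂ))) / 2) * (Y.trace * hct'
      - pauliCoord Y 0 * hcD' 0 - pauliCoord Y 1 * hcD' 1 - pauliCoord Y 2 * hcD' 2)
  have hptp : IsPTP E' := by
    refine ⟨fun X hX => ?_, fun X => ?_⟩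
    · exact conjBy_posSemidef _ (hE.isPTP.1 _ (conjBy_posSemidef _ hX))
    · rw [happly, Matrix.trace_mul_comm, ← Matrix.mul_assoc, hdual, Matrix.mul_assoc,
        Matrix.trace_mul_comm, Matrix.mul_assoc a, Matrix.nonsing_inv_mul_cancel_left _ _ hau,
        Matrix.mul_assoc, ← conjTranspose_mul, Matrix.nonsing_inv_mul _ hau, conjTranspose_one,
        Matrix.mul_one]
  obtain ⟨t', D', hD'⟩ := hptp.exists_eq_blochMap
  have ht' : t' = 0 := by
    rw [hD', ← hermPauli_two_zero, blochMap_hermPauli, Matrix.mulVec_zero, add_zero] at hunital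
    ext i
    have := congrArg (fun X => pauliCoord X i) hunital
    simp only [pauliCoord_hermPauli] at this
    simpa using this
  subst ht'
  have hdet : D'.det < 0 := by
    have h1 : LinearMap.det E' = (D'.det : ℂ) := by rw [hD', det_blochMap]
    rw [hE', map_mul, map_mul, det_conjBy, det_conjBy, det_blochMap, ← Complex.ofReal_mul,
      ← Complex.ofReal_mul, Complex.ofReal_inj] at h1
    rw [← h1]
    have hb0 : (b⁻¹).det ≠ 0 := by
      rw [Matrix.det_nonsing_inv, Ring.inverse_eq_inv']
      exact inv_ne_zero hbu.ne_zero
    have h2 := pow_pos (Complex.normSq_pos.mpr hb0) 2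
    have h3 := pow_pos (Complex.normSq_pos.mpr hau.ne_zero) 2
    exact mul_neg_of_neg_of_pos (mul_neg_of_pos_of_neg h2 hD) h3
  have hmp : IsMeasurePrepare (Option (Fin 3 × Bool)) E' := by
    rw [hD']
    refine isMeasurePrepare_of_unital hdet fun R hR hRdet => ?_
    obtain ⟨U, hU⟩ := exists_conjBy_eq_blochMap hR hRdet
    -- By cyclicity, testing the original channel with a U b⁻¹ tests the filtered one with U.
    have h1 := hE.trace_conjBy_mul_nonneg (a * U * b⁻¹)
    have h2 : LinearMap.trace ℂ _ (conjBy (a * U * b⁻¹) * blochMap t D)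
        = ((1 + (R * D').trace : ℝ) : ℂ) := by
      rw [← conjBy_mul, ← conjBy_mul, mul_assoc, mul_assoc, LinearMap.trace_mul_comm, mul_assoc,
        ← hE', hD', hU, blochMap_mul, trace_blochMap]
    rw [h2] at h1
    exact_mod_cast h1
  have hback : blochMap t D = conjBy b * E' * conjBy a⁻¹ := by
    rw [hE', mul_assoc, mul_assoc, mul_assoc, conjBy_mul, Matrix.mul_nonsing_inv _ hau, conjBy_one,
      mul_one, ← mul_assoc, conjBy_mul, Matrix.mul_nonsing_inv _ hbu, conjBy_one, one_mul]
  rw [hback]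
  exact hmp.conjBy_mul_mul_conjBy b a⁻¹

theorem isChannel_blochMap_zero_zero : IsChannel (blochMap 0 0) := by
  have h := isMeasurePrepare_blochMap_zero (W := 1) (V := 1) (by simp) (by simp) (p := 0)
    (fun _ => le_rfl) (by simp)
  have e : (1 : Matrix (Fin 3) (Fin 3) ℝ) * diagonal 0 * 1ᵀ = 0 := by simp
  rw [e] at h
  exact h.isChannel (isTracePreserving_blochMap _ _)

/-- Mixing with the completely depolarizing channel makes the map contractive without changing the
sign of the determinant. The number of outcomes stays fixed, so the mixing can be removed in the
limit. -/
theorem isMeasurePrepare_of_det_neg {t : Fin 3 → ℝ} {D : Matrix (Fin 3) (Fin 3) ℝ}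
    (hE : IsChannel (blochMap t D)) (hD : D.det < 0) :
    IsMeasurePrepare (Option (Fin 3 × Bool)) (blochMap t D) := by
  rw [isMeasurePrepare_blochMap_iff]
  have hlim : Filter.Tendsto (fun s : ℝ => (s • t, s • D)) (nhdsWithin 1 (Set.Iio 1))
      (nhds (t, D)) := by
    have hc : Continuous fun s : ℝ => (s • t, s • D) := by fun_prop
    have := hc.tendsto 1
    simp only [one_smul] at this
    exact this.mono_left nhdsWithin_le_nhds
  refine (isClosed_holevoMap_image _).mem_of_tendsto hlim ?_
  filter_upwards [Ioo_mem_nhdsLT (zero_lt_one' ℝ)] with s hs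
  rw [← isMeasurePrepare_blochMap_iff]
  have hch : IsChannel (blochMap (s • t) (s • D)) := by
    have := hE.combo isChannel_blochMap_zero_zero hs.1.le (sub_nonneg.mpr hs.2.le)
      (add_sub_cancel s 1)
    rw [blochMap_combo _ _ (add_sub_cancel s 1)] at this
    simpa using this
  refine isMeasurePrepare_of_contractive hch ?_ fun x hx => ?_
  · rw [Matrix.det_smul]
    exact mul_neg_of_pos_of_neg (pow_pos hs.1 _) hD
  · have h1 := isPTP_blochMap.mp hE.isPTP x hx
    rw [Matrix.smul_mulVec, ← smul_add, dotProduct_smul, smul_dotProduct, smul_eq_mul,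
      smul_eq_mul, ← mul_assoc]
    have h2 : s * s < 1 := by nlinarith [hs.1, hs.2]
    calc s * s * ((t + D *ᵥ x) ⬝ᵥ (t + D *ᵥ x)) ≤ s * s :=
          mul_le_of_le_one_right (mul_self_nonneg s) h1
      _ < 1 := h2

/-! ### Conclusions for channels -/

theorem isEntanglementBreaking_of_det_neg {E : Superoperator (Fin 2)} (hE : IsChannel E)
    (hdet : (pauliMatrix E).det < 0) : IsEntanglementBreaking E := by
  obtain ⟨t, D, rfl⟩ := hE.isPTP.exists_eq_blochMap
  rw [det_pauliMatrix, det_blochMap] at hdet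
  exact (isMeasurePrepare_of_det_neg hE (by exact_mod_cast hdet)).isEntanglementBreaking hE.2

theorem mem_pInfinitesimalDivisible_iff {E : Superoperator (Fin 2)} (hE : IsChannel E) :
    E ∈ pInfinitesimalDivisible (Fin 2) ↔ ¬ (pauliMatrix E).det < 0 := by
  rw [det_pauliMatrix]
  refine ⟨not_det_neg_of_mem_pInfinitesimalDivisible, fun h => ?_⟩
  obtain ⟨t, D, rfl⟩ := hE.isPTP.exists_eq_blochMap
  rw [det_blochMap] at h
  refine mem_pInfinitesimalDivisible_of_det_nonneg hE (not_lt.mp fun h' => h ?_)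
  exact_mod_cast h'

end QuantumChannel

theorem mainTheorem3 (E : QuantumChannel.Superoperator (Fin 2))
    (hE : QuantumChannel.IsChannel E) :
    ((QuantumChannel.pauliMatrix E).det < 0 → QuantumChannel.IsEntanglementBreaking E) ∧
    (E ∉ QuantumChannel.pInfinitesimalDivisible (Fin 2) ↔
      (QuantumChannel.pauliMatrix E).det < 0) ∧
    (E ∉ QuantumChannel.pInfinitesimalDivisible (Fin 2) →
      QuantumChannel.IsEntanglementBreaking E) := by
  have h := QuantumChannel.mem_pInfinitesimalDivisible_iff hE
  refine ⟨QuantumChannel.isEntanglementBreaking_of_det_neg hE, by rw [h, not_not], fun hn => ?_⟩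
  rw [h, not_not] at hn
  exact QuantumChannel.isEntanglementBreaking_of_det_neg hE hn
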